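/- For $n\ge 1$ define the HiPPO-LegS matrices $A_H\in\mathbb R^{n\times n}$, $B_H\in\mathbb R^{n}$ by $(A_H)_{jj}=-j$, $(A_H)_{jk}=-\sqrt{2j-1}\sqrt{2k-1}$ for $j>k$, $(A_H)_{jk}=0$ for $j<k$, and $(B_H)_j=\sqrt{(2j-1)/2}$ $(1\le j,k\le n)$. Put $A_H^\perp=A_H+B_HB_H^\top$, i.e. $(A_H^\perp)_{jj}=-\tfrac12$, $(A_H^\perp)_{jk}=-\tfrac12\sqrt{2j-1}\sqrt{2k-1}$ for $j>k$ and $(A_H^\perp)_{jk}=+\tfrac12\sqrt{2j-1}\sqrt{2k-1}$ for $j<k$. This matrix is normal; let $A_H^\perp=V_H\Lambda_HV_H^{-1}$ be any diagonalization with $V_H$ unitary and $\Lambda_H$ diagonal. Fix $1\le \ell\le n$ and $D\in\mathbb C$, and let $C=e_\ell^\top V_H$, where $e_\ell$ is the $\ell$th standard basis vector. Consider the linear time-invariant systems $x'=Ax+Bu$, $y=Cx+Du$ with these $C$, $D$ and $$\Sigma_{\mathrm{DPLR}}\ (\text{S4}):\quad A=\Lambda_H-V_H^{-1}B_HB_H^\top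 V_H,\quad B=V_H^{-1}B_H;\qquad \Sigma_{\mathrm{Diag}}\ (\text{S4D}):\quad A=\Lambda_H,\quad B=\tfrac12V_H^{-1}B_H .$$ The output of such a system, started at rest, for an input $u\in L^2(\mathbb R)$ (complex valued) is $y(t)=C\int_{-\infty}^t e^{(t-\tau)A}B\,u(\tau)\,d\tau+Du(t)$, $t\in\mathbb R$; for an input that vanishes for $t<0$ this is the output of the system with initial state $x(0)=0$ (extended by $0$ to $t<0$). Write $\hat u(s)=\int_{\mathbb R}u(t)e^{-ist}\,dt$ for the Fourier transform, extended to $L^2(\mathbb R)$. **Theorem.** Let $q'>1/2$ and $K>0$. There is a constant $M>0$, depending only on $q'$ and $K$, with the following property. Let $s_0\in\mathbb R$. Then there is an $N\in\mathbb N$, depending only on $q'$, $K$ and $s_0$, such that for every $q\ge q'$ and every $u\in L^2(\mathbb R)$ with $\|u\|_{L^2}=1$ and $$|\hat u(s)|\le K|s|^{-q}\quad\text{for almost every } s \text{ with } |s|\ge s_0,$$ for every $n\ge N$, $1\le\ell\le n$, $D$ and $(V_H,\Lambda_H)$ as above, the outputs $y_{\mathrm{DPLR}}$, $y_{\mathrm{Diag}}$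 of $\Sigma_{\mathrm{DPLR}}$, $\Sigma_{\mathrm{Diag}}$ given the input $u$ satisfy $y_{\mathrm{DPLR}}-y_{\mathrm{Diag}}\in L^2(\mathbb R)$ and $$\|y_{\mathrm{DPLR}}-y_{\mathrm{Diag}}\|_{L^2}\le M\,n^{-1}\sqrt{\ell}.$$ In other words, if $|\hat u(s)|=\mathcal O(|s|^{-q})$ for some $q>1/2$, then $\|y_{\mathrm{DPLR}}-y_{\mathrm{Diag}}\|_{L^2}=\mathcal O(n^{-1})\sqrt\ell$ as $n\to\infty$, with a constant that depends only on $q$ and on the constant of the decay of $\hat u$, and that can be chosen independently of $q$ on $[q',\infty)$. -/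

import Mathlib

open MeasureTheory Filter Topology
open scoped FourierTransform Matrix ENNReal

noncomputable section

/-! ### Single-input/single-output linear time-invariant systems -/

/-- A single-input/single-output LTI system `x' = A x + B u`, `y = C x + D u` with `n` states. -/
structure LTISystem (n : ℕ) where
  /-- state matrix -/
  A : Matrix (Fin n) (Fin n) ℂ
  /-- input matrix, a column vector -/
  B : Fin n → ℂ
  /-- output matrix, a row vector -/
  C : Fin n → ℂ
  /-- feedthrough -/
  D : ℂ

namespace LTISystem

variable {n : ℕ}

/-- The state of the system that starts at rest and is driven by the input `u`, given by variation
of constants. The input is a signal on the whole time axis; if it is switched on at time `0`, that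
is, vanishes for negative times, then this is the solution of `x' = A x + B u`, `x 0 = 0`
(see `state_zero`, `state_eq` and `ae_hasDerivAt_state`). -/
def state (S : LTISystem n) (u : ℝ → ℂ) (t : ℝ) : Fin n → ℂ :=
  ∫ τ in Set.Iic t, u τ • (NormedSpace.exp ((t - τ) • S.A) *ᵥ S.B)

/-- The output `y = C x + D u` of the system that starts at rest. -/
def output (S : LTISystem n) (u : ℝ → ℂ) (t : ℝ) : ℂ :=
  S.C ⬝ᵥ S.state u t + S.D * u t

/-- The state vanishes at time `0` if the input is switched on at time `0`. -/
theorem state_zero (S : LTISystem n) {u : ℝ → ℂ} (hu : ∀ᵐ t : ℝ, t < 0 → u t = 0) : S.state u 0 = 0 := by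
  unfold state
  rw [integral_Iic_eq_integral_Iio]
  refine setIntegral_eq_zero_of_ae_eq_zero ?_
  filter_upwards [hu] with τ hτ hτ'
  rw [hτ hτ', zero_smul]

/-- The state factors through a primitive if the input is switched on at time `0`. -/
theorem state_eq (S : LTISystem n) {u : ℝ → ℂ} (hu : ∀ᵐ t : ℝ, t < 0 → u t = 0)
    (hui : LocallyIntegrable u volume) {t : ℝ} (ht : 0 ≤ t) :
    S.state u t = NormedSpace.exp (t • S.A) *ᵥ
      ∫ τ in (0 : ℝ)..t, u τ • (NormedSpace.exp ((-τ) • S.A) *ᵥ S.B) := by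
  have hcont : Continuous fun τ : ℝ => NormedSpace.exp ((-τ) • S.A) *ᵥ S.B := by
    let _ : NormedRing (Matrix (Fin n) (Fin n) ℂ) := Matrix.linftyOpNormedRing
    let _ : NormedAlgebra ℝ (Matrix (Fin n) (Fin n) ℂ) := Matrix.linftyOpNormedAlgebra
    let _ : NormedAlgebra ℚ (Matrix (Fin n) (Fin n) ℂ) := Matrix.linftyOpNormedAlgebra
    have h : Continuous fun τ : ℝ => NormedSpace.exp ((-τ) • S.A) :=
      NormedSpace.exp_continuous.comp (continuous_neg.smul continuous_const)
    exact h.matrix_mulVec continuous_const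
  have hint : IntervalIntegrable (fun τ => u τ • (NormedSpace.exp ((-τ) • S.A) *ᵥ S.B))
      volume 0 t :=
    IntervalIntegrable.smul_continuousOn
      (intervalIntegrable_iff.2 ((hui.integrableOn_isCompact isCompact_uIcc).mono_set
        Set.uIoc_subset_uIcc)) hcont.continuousOn
  let L : (Fin n → ℂ) →L[ℂ] (Fin n → ℂ) :=
    (Matrix.mulVecLin (NormedSpace.exp (t • S.A))).toContinuousLinearMap
  have hL : ∀ v, L v = NormedSpace.exp (t • S.A) *ᵥ v := fun v => rfl
  have hfun : ∀ τ : ℝ, L (u τ • (NormedSpace.exp ((-τ) • S.A) *ᵥ S.B))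
      = u τ • (NormedSpace.exp ((t - τ) • S.A) *ᵥ S.B) := by
    intro τ
    have hexp : NormedSpace.exp ((t - τ) • S.A)
        = NormedSpace.exp (t • S.A) * NormedSpace.exp ((-τ) • S.A) := by
      rw [← Matrix.exp_add_of_commute, sub_eq_add_neg, add_smul]
      exact ((Commute.refl S.A).smul_left t).smul_right (-τ)
    rw [hL, hexp, Matrix.mulVec_smul, Matrix.mulVec_mulVec]
  rw [← hL, ← L.intervalIntegral_comp_comm hint, intervalIntegral.integral_of_le ht,
    ← integral_Icc_eq_integral_Ioc]
  simp only [hfun]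
  unfold state
  refine setIntegral_eq_of_subset_of_ae_sdiff_eq_zero measurableSet_Iic.nullMeasurableSet
    Set.Icc_subset_Iic_self ?_
  filter_upwards [hu] with τ hτ hτ'
  have : τ < 0 := by
    by_contra h
    exact hτ'.2 ⟨not_lt.1 h, hτ'.1⟩
  rw [hτ this, zero_smul]

/-- The state solves `x' = A x + B u` if the input is switched on at time `0`. -/
theorem ae_hasDerivAt_state (S : LTISystem n) {u : ℝ → ℂ} (hu : ∀ᵐ t : ℝ, t < 0 → u t = 0)
    (hui : LocallyIntegrable u volume) :
    ∀ᵐ t : ℝ, 0 < t → HasDerivAt (S.state u) (S.A *ᵥ S.state u t + u t • S.B) t := by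
  let _ : NormedRing (Matrix (Fin n) (Fin n) ℂ) := Matrix.linftyOpNormedRing
  let _ : NormedAlgebra ℝ (Matrix (Fin n) (Fin n) ℂ) := Matrix.linftyOpNormedAlgebra
  let _ : NormedAlgebra ℚ (Matrix (Fin n) (Fin n) ℂ) := Matrix.linftyOpNormedAlgebra
  have hcont : Continuous fun τ : ℝ => NormedSpace.exp ((-τ) • S.A) *ᵥ S.B := by
    have h : Continuous fun τ : ℝ => NormedSpace.exp ((-τ) • S.A) :=
      NormedSpace.exp_continuous.comp (continuous_neg.smul continuous_const)
    exact h.matrix_mulVec continuous_const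
  have hloc : LocallyIntegrable (fun τ => u τ • (NormedSpace.exp ((-τ) • S.A) *ᵥ S.B)) := by
    refine (locallyIntegrable_iff).2 fun K hK => ?_
    exact (hui.integrableOn_isCompact hK).smul_continuousOn hcont.continuousOn hK
  filter_upwards [LocallyIntegrable.ae_hasDerivAt_integral hloc] with t ht ht0
  have hg := ht 0
  have hE := hasDerivAt_exp_smul_const' (𝕂 := ℝ) S.A t
  let Bil : Matrix (Fin n) (Fin n) ℂ →L[ℝ] (Fin n → ℂ) →L[ℝ] (Fin n → ℂ) :=
    (LinearMap.toContinuousLinearMap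
      ((LinearMap.toContinuousLinearMap :
        ((Fin n → ℂ) →ₗ[ℝ] (Fin n → ℂ)) ≃ₗ[ℝ] _).toLinearMap ∘ₗ
        (Matrix.mulVecBilin ℝ ℝ)))
  have hB : ∀ M v, Bil M v = M *ᵥ v := fun M v => rfl
  have hprod := Bil.hasDerivAt_of_bilinear (fun _ => hE) (fun _ => hg)
  have heq : S.state u =ᶠ[𝓝 t] fun r => Bil (NormedSpace.exp (r • S.A))
      (∫ τ in (0 : ℝ)..r, u τ • (NormedSpace.exp ((-τ) • S.A) *ᵥ S.B)) := by
    filter_upwards [lt_mem_nhds ht0] with r hr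
    rw [hB, S.state_eq hu hui hr.le]
  refine (hprod.congr_of_eventuallyEq heq).congr_deriv ?_
  have hinv : NormedSpace.exp (t • S.A) * NormedSpace.exp ((-t) • S.A) = 1 := by
    rw [← Matrix.exp_add_of_commute, ← add_smul, add_neg_cancel, zero_smul, NormedSpace.exp_zero]
    exact ((Commute.refl S.A).smul_left t).smul_right (-t)
  change NormedSpace.exp (t • S.A) *ᵥ (u t • (NormedSpace.exp ((-t) • S.A) *ᵥ S.B))
    + (S.A * NormedSpace.exp (t • S.A)) *ᵥ
      (∫ τ in (0 : ℝ)..t, u τ • (NormedSpace.exp ((-τ) • S.A) *ᵥ S.B)) = _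
  rw [S.state_eq hu hui ht0.le, Matrix.mulVec_smul, Matrix.mulVec_mulVec,
    Matrix.mulVec_mulVec, hinv, Matrix.one_mulVec, add_comm]

end LTISystem

/-! ### The HiPPO-LegS matrices

Row `j` of the mathematical indexing `1, …, n` is the row `j - 1` of `Fin n`, so that
`√(2 j - 1)` reads `√(2 j + 1)` here. -/

/-- The HiPPO-LegS state matrix. -/
def hippoA (n : ℕ) : Matrix (Fin n) (Fin n) ℂ := fun j k =>
  -(if j = k then ((j : ℕ) + 1 : ℂ)
    else if k < j then ((√(2 * (j : ℕ) + 1) * √(2 * (k : ℕ) + 1) : ℝ) : ℂ) else 0)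

/-- The HiPPO-LegS input vector. -/
def hippoB (n : ℕ) : Fin n → ℂ := fun j => ((√((2 * (j : ℕ) + 1) / 2) : ℝ) : ℂ)

/-- The normal part of the HiPPO-LegS state matrix. -/
def hippoAperp (n : ℕ) : Matrix (Fin n) (Fin n) ℂ := fun j k =>
  -(1 / 2) * (if j = k then 1
    else (if j < k then -1 else 1) * ((√(2 * (j : ℕ) + 1) * √(2 * (k : ℕ) + 1) : ℝ) : ℂ))

/-- The diagonal-plus-rank-one structure of the HiPPO-LegS state matrix. -/
theorem hippoA_eq (n : ℕ) :
    hippoA n = hippoAperp n - Matrix.vecMulVec (hippoB n) (hippoB n) := by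
  have key : ∀ j k : Fin n, hippoB n j * hippoB n k
      = 1 / 2 * ((√(2 * (j : ℕ) + 1) * √(2 * (k : ℕ) + 1) : ℝ) : ℂ) := by
    intro j k
    have h2 : (√2 : ℝ) * √2 = 2 := Real.mul_self_sqrt (by norm_num)
    have : √((2 * ((j : ℕ) : ℝ) + 1) / 2) * √((2 * ((k : ℕ) : ℝ) + 1) / 2)
        = 1 / 2 * (√(2 * (j : ℕ) + 1) * √(2 * (k : ℕ) + 1)) := by
      rw [Real.sqrt_div (by positivity), Real.sqrt_div (by positivity), div_mul_div_comm, h2]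
      ring
    simp only [hippoB]
    rw [← Complex.ofReal_mul, this]
    push_cast
    ring
  ext j k
  rw [Matrix.sub_apply, Matrix.vecMulVec_apply, key]
  simp only [hippoA, hippoAperp]
  rcases lt_trichotomy j k with h | h | h
  · rw [if_neg h.ne, if_neg h.not_gt, if_neg h.ne, if_pos h]
    ring
  · subst h
    rw [if_pos rfl, if_pos rfl, Real.mul_self_sqrt (by positivity)]
    push_cast
    ring
  · rw [if_neg h.ne', if_pos h, if_neg h.ne', if_neg h.not_gt]
    ring

/-- `V` and `lam` form a unitary diagonalization `V * diag lam * V⁻¹` of `hippoAperp n`. -/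
structure IsHippoDiagonalization {n : ℕ} (V : Matrix (Fin n) (Fin n) ℂ) (lam : Fin n → ℂ) :
    Prop where
  unitary : V ∈ Matrix.unitaryGroup (Fin n) ℂ
  diagonalizes : hippoAperp n = V * Matrix.diagonal lam * V⁻¹

/-- Unitary diagonalizations exist. -/
theorem exists_isHippoDiagonalization (n : ℕ) :
    ∃ (V : Matrix (Fin n) (Fin n) ℂ) (lam : Fin n → ℂ), IsHippoDiagonalization V lam := by
  have hH : (Complex.I • (hippoAperp n + (1 / 2 : ℂ) • 1)).IsHermitian := by
    ext j k
    simp only [Matrix.conjTranspose_apply, Matrix.smul_apply, Matrix.add_apply, smul_eq_mul,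
      hippoAperp, Matrix.one_apply]
    rcases lt_trichotomy j k with h | h | h
    · simp [h.ne, h.ne', h, h.not_gt]
      ring
    · subst h
      simp
    · simp [h.ne, h.ne', h, h.not_gt]
      ring
  have hs := hH.spectral_theorem
  set U := hH.eigenvectorUnitary with hU
  have hinv : ((U : Matrix (Fin n) (Fin n) ℂ))⁻¹ = star (U : Matrix (Fin n) (Fin n) ℂ) :=
    Matrix.inv_eq_right_inv (Unitary.coe_mul_star_self U)
  refine ⟨U, fun i => -Complex.I * hH.eigenvalues i - 1 / 2, U.2, ?_⟩
  have hd : Matrix.diagonal (fun i => -Complex.I * (hH.eigenvalues i : ℂ) - 1 / 2)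
      = (-Complex.I) • Matrix.diagonal (RCLike.ofReal ∘ hH.eigenvalues : Fin n → ℂ)
        - (1 / 2 : ℂ) • 1 := by
    ext j k
    by_cases h : j = k
    · subst h; simp
    · simp [h]
  have hA : hippoAperp n
      = (-Complex.I) • (Complex.I • (hippoAperp n + (1 / 2 : ℂ) • 1)) - (1 / 2 : ℂ) • 1 := by
    rw [smul_smul]
    simp
  refine hA.trans ?_
  rw [hd, hinv, mul_sub, sub_mul]
  refine congrArg₂ (fun X Y => X - Y) ?_ ?_
  · rw [Matrix.mul_smul, Matrix.smul_mul]
    refine congrArg (fun X => (-Complex.I) • X) (hs.trans ?_)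
    rw [Unitary.conjStarAlgAut_apply]
  · rw [Matrix.mul_smul, mul_one, Matrix.smul_mul, ← Unitary.coe_star, Unitary.coe_mul_star_self U]

/-! ### The two initializations -/

/-- The S4 (DPLR) system with respect to the unitary diagonalization `V * diag lam * V⁻¹` of
`hippoAperp n`, with output matrix `e_l^T V` and feedthrough `D`. -/
def sysDPLR {n : ℕ} (V : Matrix (Fin n) (Fin n) ℂ) (lam : Fin n → ℂ) (l : Fin n) (D : ℂ) :
    LTISystem n where
  A := Matrix.diagonal lam - V⁻¹ * Matrix.vecMulVec (hippoB n) (hippoB n) * V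
  B := V⁻¹ *ᵥ hippoB n
  C := Pi.single l 1 ᵥ* V
  D := D

/-- The S4D (diagonal) system with respect to the same data. -/
def sysDiag {n : ℕ} (V : Matrix (Fin n) (Fin n) ℂ) (lam : Fin n → ℂ) (l : Fin n) (D : ℂ) :
    LTISystem n where
  A := Matrix.diagonal lam
  B := (1 / 2 : ℂ) • (V⁻¹ *ᵥ hippoB n)
  C := Pi.single l 1 ᵥ* V
  D := D

/-! ### Fourier transform -/

/-- The Fourier transform `û(s) = ∫ u(t) e^{-ist} dt` on `L²(ℝ)`, as a function of the angular
frequency `s`. Mathlib's `𝓕` on `L²` extends `∫ u(t) e^{-2πiξt} dt`; thus `û(s) = 𝓕 u (s / 2π)`.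
Like `u`, it is defined up to a null set. -/
def angularFourier (u : Lp ℂ 2 (volume : Measure ℝ)) (s : ℝ) : ℂ :=
  (𝓕 u : Lp ℂ 2 (volume : Measure ℝ)) (s / (2 * Real.pi))

end

/-!
Both systems are unitarily similar to systems with state matrices `hippoA n` and `hippoAperp n`, so
the outputs differ by the convolution of `u` with a fixed kernel `k` (`impulseDiff`), which decays
exponentially because both matrices have their numerical range in `Re z ≤ -1/2`. By Plancherel's
theorem (`eLpNorm_convolution_eq`) it remains to bound `∫ |k̂|² |û|²`.

Write `A`, `A⊥`, `B` for `hippoA n`, `hippoAperp n`, `hippoB n`, put `g(s) = Bᵀ (s - A⊥)⁻¹ B` and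
`w(s) = ∏_{j<n} (s - j) / (s + j + 1)`. Forward substitution in the triangular matrix `s - A` and
the Sherman–Morrison formula give `g = (1 - w) / (1 + w)` and
`k̂(ω) = (iω - A)⁻¹ B · (1 - g(iω)) / 2` in the coordinate in question. Since
`|w(iω)|² = ω² / (ω² + n²)`, this implies `|k̂(ω)|² ≤ (l + 1) n⁻² Re g(iω)` with the zero-based
index `l`, and `Re g(iω) ≤ 6` for `|ω| ≤ n` (`normSq_resolvent_sub_le`). This settles the low
frequencies.

For `|ω| ≥ n` the function `Re g(iω)` has high and narrow peaks. It is, however, the restriction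
of a positive harmonic function: the eigenvalues of `A⊥` lie on `Re z = -1/2`, so that `Re g` is a
sum of Poisson kernels of the half plane to the right of this line
(`IsHippoDiagonalization.dotProduct_resolvent`). At a real point `T ≥ n` one has `w(T) ≥ 0`, whence
`g(T) ≤ 1`, and comparison of Poisson kernels shows that the mean of `Re g(iω)` over `|ω| ≤ 2 T` is
bounded. Summation over dyadic shells bounds `∫_{|ω| ≥ n} Re g(iω) |ω|^(-2 q')`, as `2 q' > 1`
(`lintegral_poisson_le`).
-/

noncomputable section

/-! ### Convolution operators on `L²` -/

/-- On `L¹ ∩ L²` the Fourier transform of `L²` is given by the Fourier integral. -/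
theorem fourier_toLp_ae_eq {f : ℝ → ℂ} (hf1 : Integrable f) (hf2 : MemLp f 2) :
    (𝓕 (hf2.toLp f) : Lp ℂ 2 (volume : Measure ℝ)) =ᵐ[volume] 𝓕 f := by
  refine ae_eq_of_integral_contDiff_smul_eq
    ((Lp.memLp _).locallyIntegrable (by norm_num)) ?_ ?_
  · have hc : Continuous (𝓕 f) := VectorFourier.fourierIntegral_continuous
      Real.continuous_fourierChar (by exact continuous_inner) hf1
    exact hc.locallyIntegrable
  · intro g hg hgc
    have hg₁ : HasCompactSupport (Complex.ofRealCLM ∘ g) := hgc.comp_left rfl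
    have hg₂ : ContDiff ℝ ((⊤ : ℕ∞) : WithTop ℕ∞) (Complex.ofRealCLM ∘ g) :=
      Complex.ofRealCLM.contDiff.comp hg
    set φ := hg₁.toSchwartzMap hg₂ with hφ
    have h1 := congrArg (fun F : TemperedDistribution ℝ ℂ => F φ)
      (Lp.fourier_toTemperedDistribution_eq (hf2.toLp f))
    simp only [TemperedDistribution.fourier_apply, Lp.toTemperedDistribution_apply] at h1
    have h2 : ∫ x, g x • (𝓕 (hf2.toLp f) : Lp ℂ 2 (volume : Measure ℝ)) x
        = ∫ x, φ x • (𝓕 (hf2.toLp f) : Lp ℂ 2 (volume : Measure ℝ)) x := by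
      simp [hφ]
    rw [h2, ← h1]
    have h3 : ∫ x, (𝓕 φ) x • (hf2.toLp f) x = ∫ x, (𝓕 φ) x • f x := by
      refine integral_congr_ae ?_
      filter_upwards [hf2.coeFn_toLp] with x hx
      rw [hx]
    have h4 : ∫ x, (𝓕 (φ : ℝ → ℂ)) x • f x = ∫ x, φ x • 𝓕 f x := by
      have := VectorFourier.integral_fourierIntegral_smul_eq_flip (L := innerₗ ℝ)
        (μ := volume) (ν := volume) Real.continuous_fourierChar (by exact continuous_inner)
        φ.integrable hf1
      simpa [Real.fourier_eq, VectorFourier.fourierIntegral, real_inner_comm] using this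
    rw [h3, SchwartzMap.fourier_coe, h4]
    simp [hφ]

/-- Plancherel's theorem on `L¹ ∩ L²`, for the inverse Fourier integral. -/
theorem eLpNorm_fourierInv_eq {f : ℝ → ℂ} (hf1 : Integrable f) (hf2 : MemLp f 2) :
    MemLp (𝓕⁻ f) 2 ∧ eLpNorm (𝓕⁻ f) 2 = eLpNorm f 2 := by
  have hneg := Measure.measurePreserving_neg (volume : Measure ℝ)
  have hF : MemLp (𝓕 f) 2 ∧ eLpNorm (𝓕 f) 2 = eLpNorm f 2 := by
    have hae := fourier_toLp_ae_eq hf1 hf2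
    refine ⟨(memLp_congr_ae hae).1 (Lp.memLp _), ?_⟩
    rw [← eLpNorm_congr_ae hae, ← eLpNorm_congr_ae hf2.coeFn_toLp, ← Lp.enorm_def, ← Lp.enorm_def,
      enorm_eq_iff_norm_eq, Lp.norm_fourier_eq]
  have hcomp : 𝓕⁻ f = 𝓕 f ∘ Neg.neg := by
    ext x
    exact Real.fourierInv_eq_fourier_neg f x
  rw [hcomp]
  exact ⟨hF.1.comp_measurePreserving hneg,
    (eLpNorm_comp_measurePreserving hF.1.1 hneg).trans hF.2⟩

/-- The Fourier integral of a reflected, shifted and conjugated function. -/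
theorem fourier_star_comp_sub (k : ℝ → ℂ) (t ξ : ℝ) :
    𝓕 (fun τ => star (k (t - τ))) ξ = star (Real.fourierChar (t * ξ) • 𝓕 k ξ) := by
  rw [Real.fourier_real_eq, Real.fourier_real_eq, ← integral_sub_left_eq_self _ volume t]
  simp only [sub_sub_cancel]
  simp only [Circle.smul_def]
  rw [← integral_smul, Complex.star_def, ← integral_conj]
  refine integral_congr_ae (Eventually.of_forall fun x => ?_)
  simp only [smul_eq_mul, map_mul, ← Circle.coe_inv_eq_conj]
  rw [← mul_assoc, ← Circle.coe_mul, ← AddChar.map_neg_eq_inv, ← AddChar.map_neg_eq_inv,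
    ← AddChar.map_add_eq_mul]
  congr 3
  ring_nf

/-- Convolution with a kernel in `L¹ ∩ L²` acts on `L²` as multiplication of the Fourier transform
by the Fourier integral of the kernel. -/
theorem eLpNorm_convolution_eq {k : ℝ → ℂ} (hk1 : Integrable k) (hk2 : MemLp k 2)
    (u : Lp ℂ 2 (volume : Measure ℝ)) :
    MemLp (fun t => ∫ τ, u τ * k (t - τ)) 2 ∧
      eLpNorm (fun t => ∫ τ, u τ * k (t - τ)) 2
        = eLpNorm (fun ξ => 𝓕 k ξ * (𝓕 u : Lp ℂ 2 (volume : Measure ℝ)) ξ) 2 := by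
  set U : Lp ℂ 2 (volume : Measure ℝ) := 𝓕 u with hU
  have hkF : MemLp (𝓕 k) 2 := (memLp_congr_ae (fourier_toLp_ae_eq hk1 hk2)).1 (Lp.memLp _)
  have hkb : ∀ ξ, ‖𝓕 k ξ‖ ≤ ∫ v, ‖k v‖ := fun ξ =>
    VectorFourier.norm_fourierIntegral_le_integral_norm _ _ _ _ _
  have hg1 : Integrable (fun ξ => 𝓕 k ξ * U ξ) := hkF.integrable_mul (Lp.memLp U)
  have hg2 : MemLp (fun ξ => 𝓕 k ξ * U ξ) 2 := by
    refine (Lp.memLp U).of_le_mul (c := ∫ v, ‖k v‖) (hkF.1.mul (Lp.memLp U).1)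
      (Eventually.of_forall fun ξ => ?_)
    rw [norm_mul]
    gcongr
    exact hkb ξ
  -- The convolution at `t` is the inner product of `u` with the reflected and shifted kernel.
  have key : (fun t => ∫ τ, u τ * k (t - τ)) = 𝓕⁻ (fun ξ => 𝓕 k ξ * U ξ) := by
    ext t
    have hmp := Measure.measurePreserving_sub_left (volume : Measure ℝ) t
    have hf1 : Integrable (fun τ => star (k (t - τ))) := 
      memLp_one_iff_integrable.1 (memLp_one_iff_integrable.2 (hk1.comp_sub_left t)).star
    have hf2 : MemLp (fun τ => star (k (t - τ))) 2 := (hk2.comp_measurePreserving hmp).star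
    have h := Lp.inner_fourier_eq (hf2.toLp _) u
    rw [L2.inner_def, L2.inner_def, ← hU] at h
    have hl : ∫ τ, u τ * k (t - τ) = ∫ τ, inner ℂ ((hf2.toLp _) τ) (u τ) := by
      refine integral_congr_ae ?_
      filter_upwards [hf2.coeFn_toLp] with τ hτ
      rw [hτ]
      simp
    rw [hl, ← h, Real.fourierInv_eq]
    refine integral_congr_ae ?_
    filter_upwards [fourier_toLp_ae_eq hf1 hf2] with ξ hξ
    rw [hξ, fourier_star_comp_sub]
    simp [Circle.smul_def, mul_comm, mul_left_comm]
  rw [key]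
  exact eLpNorm_fourierInv_eq hg1 hg2

/-! ### Resolvents of the HiPPO-LegS matrices -/

/-- The rational function `∏_{j<m} (s - j) / (s + j + 1)`. It occurs in forward substitution for the
triangular matrix `s - hippoA n`, and its reflection `s ↦ -s` exchanges zeros and poles up to a
shift by one, whence the simple modulus on the imaginary axis. -/
def legsW (m : ℕ) (s : ℂ) : ℂ := ∏ j ∈ Finset.range m, (s - j) / (s + (j + 1))

theorem legsW_succ (m : ℕ) (s : ℂ) : legsW (m + 1) s = legsW m s * ((s - m) / (s + (m + 1))) :=
  Finset.prod_range_succ _ _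

theorem hippoB_mul_self {n : ℕ} (j : Fin n) : hippoB n j * hippoB n j = (2 * (j : ℕ) + 1) / 2 := by
  simp only [hippoB]
  rw [← Complex.ofReal_mul, Real.mul_self_sqrt (by positivity)]
  push_cast
  ring

/-- The entries of `hippoA` in terms of those of `hippoB`. -/
theorem hippoA_apply {n : ℕ} (j k : Fin n) :
    hippoA n j k = -((if j = k then ((j : ℕ) + 1 : ℂ) else 0)
      + hippoB n j * (if k < j then 2 * hippoB n k else 0)) := by
  simp only [hippoA]
  rcases lt_trichotomy j k with h | h | h
  · simp [h.ne, h.not_gt]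
  · simp [h]
  · have h2 : (√(2 * ((j : ℕ) : ℝ) + 1) * √(2 * ((k : ℕ) : ℝ) + 1) : ℝ)
        = √((2 * ((j : ℕ) : ℝ) + 1) / 2) * (2 * √((2 * ((k : ℕ) : ℝ) + 1) / 2)) := by
      have h2 : (√2 : ℝ) * √2 = 2 := Real.mul_self_sqrt (by norm_num)
      have h3 : (√2 : ℝ) ≠ 0 := by positivity
      rw [Real.sqrt_div (by positivity), Real.sqrt_div (by positivity)]
      field_simp
      linear_combination h2
    rw [h2]
    simp [h.ne', h, hippoB]

/-- Forward substitution in the triangular system `(s - hippoA n) x = c • hippoB n`. -/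
theorem hippoA_resolvent {n : ℕ} {s c : ℂ} (hs : ∀ j : ℕ, s + (j + 1) ≠ 0) {x : Fin n → ℂ}
    (hx : s • x - hippoA n *ᵥ x = c • hippoB n) :
    (∀ l : Fin n, x l = c * (hippoB n l * (legsW l s / (s + ((l : ℕ) + 1))))) ∧
      hippoB n ⬝ᵥ x = c * ((1 - legsW n s) / 2) := by
  have hrow : ∀ l : Fin n, x l * (s + ((l : ℕ) + 1))
      = hippoB n l * (c - 2 * ∑ k : Fin n, if k < l then hippoB n k * x k else 0) := by
    intro l
    have h := congrFun hx l
    simp only [Pi.sub_apply, Pi.smul_apply, smul_eq_mul, Matrix.mulVec, dotProduct, hippoA_apply]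
      at h
    have e : ∑ k : Fin n, -((if l = k then ((l : ℕ) + 1 : ℂ) else 0)
        + hippoB n l * (if k < l then 2 * hippoB n k else 0)) * x k
        = -(((l : ℕ) + 1) * x l)
          - hippoB n l * (2 * ∑ k : Fin n, if k < l then hippoB n k * x k else 0) := by
      rw [Finset.mul_sum, Finset.mul_sum, sub_eq_add_neg, ← Finset.sum_neg_distrib]
      have e1 : -((((l : ℕ) : ℂ) + 1) * x l)
          = ∑ k : Fin n, if l = k then -((((l : ℕ) : ℂ) + 1) * x k) else 0 := by simp
      rw [e1, ← Finset.sum_add_distrib]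
      refine Finset.sum_congr rfl fun k _ => ?_
      split_ifs <;> ring
    rw [e] at h
    linear_combination h
  -- Row `m` of the system updates the partial sum by the factor `(s - m) / (s + m + 1)`.
  have hsum : ∀ m : ℕ, m ≤ n →
      c - 2 * ∑ k : Fin n, (if (k : ℕ) < m then hippoB n k * x k else 0) = c * legsW m s := by
    intro m
    induction m with
    | zero => simp [legsW]
    | succ m ih =>
      intro hm
      have ih := ih (by omega)
      have hr := hrow ⟨m, hm⟩
      simp only [Fin.lt_def] at hr
      rw [ih] at hr
      have e : ∑ k : Fin n, (if (k : ℕ) < m + 1 then hippoB n k * x k else 0)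
          = ∑ k : Fin n, (if (k : ℕ) < m then hippoB n k * x k else 0)
            + hippoB n ⟨m, hm⟩ * x ⟨m, hm⟩ := by
        have e1 : hippoB n ⟨m, hm⟩ * x ⟨m, hm⟩
            = ∑ k : Fin n, if k = ⟨m, hm⟩ then hippoB n k * x k else 0 := by simp
        rw [e1, ← Finset.sum_add_distrib]
        refine Finset.sum_congr rfl fun k _ => ?_
        rcases lt_trichotomy (k : ℕ) m with h | h | h
        · simp [h, Fin.ext_iff, h.ne, Nat.lt_succ_of_lt h]
        · simp [h, Fin.ext_iff]
        · simp [h.not_gt, Fin.ext_iff, h.ne', show ¬ (k : ℕ) < m + 1 by omega]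
      have hB := hippoB_mul_self (⟨m, hm⟩ : Fin n)
      have hsm := hs m
      rw [e, legsW_succ]
      field_simp
      linear_combination (s + (m + 1)) * ih - 2 * hippoB n ⟨m, hm⟩ * hr
        - 2 * c * legsW m s * hB
  refine ⟨fun l => ?_, ?_⟩
  · have hr := hrow l
    simp only [Fin.lt_def] at hr
    rw [hsum l l.2.le] at hr
    have hsl := hs l
    field_simp
    linear_combination hr
  · have h := hsum n le_rfl
    simp only [Fin.is_lt, if_true] at h
    rw [dotProduct]
    linear_combination (-1 / 2 : ℂ) * h

/-- The Sherman–Morrison relation between the two resolvents. With `g = Bᵀ (s - A⊥)⁻¹ B`, the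
function `legsW` is the Cayley transform `(1 - g) / (1 + g)`. -/
theorem hippoAperp_resolvent {n : ℕ} {s : ℂ} (hs : ∀ j : ℕ, s + (j + 1) ≠ 0) {x : Fin n → ℂ}
    (hx : s • x - hippoAperp n *ᵥ x = hippoB n) :
    (∀ l : Fin n, x l = (1 + hippoB n ⬝ᵥ x) *
        (hippoB n l * (legsW l s / (s + ((l : ℕ) + 1))))) ∧
      (hippoB n ⬝ᵥ x) * (1 + legsW n s) = 1 - legsW n s := by
  have h : s • x - hippoA n *ᵥ x = (1 + hippoB n ⬝ᵥ x) • hippoB n := by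
    rw [hippoA_eq, Matrix.sub_mulVec, Matrix.vecMulVec_mulVec, add_smul, one_smul, ← hx]
    ext i
    simp
    ring
  obtain ⟨h1, h2⟩ := hippoA_resolvent hs h
  exact ⟨h1, by linear_combination 2 * h2⟩

/-- The modulus of `legsW` on the imaginary axis. -/
theorem normSq_legsW_mul (n : ℕ) (ω : ℝ) :
    Complex.normSq (legsW (n + 1) (ω * Complex.I)) * (ω ^ 2 + (n + 1) ^ 2) = ω ^ 2 := by
  induction n with
  | zero =>
    have : ω ^ 2 + 1 ≠ 0 := by positivity
    simp [legsW, Complex.normSq_apply]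
    field_simp
    ring
  | succ n ih =>
    rw [legsW_succ, map_mul, map_div₀]
    have e1 : Complex.normSq (ω * Complex.I - ((n + 1 : ℕ) : ℂ)) = ω ^ 2 + (n + 1) ^ 2 := by
      simp [Complex.normSq_apply]; ring
    have e2 : Complex.normSq (ω * Complex.I + (((n + 1 : ℕ) : ℂ) + 1))
        = ω ^ 2 + ((n + 1 : ℕ) + 1) ^ 2 := by
      simp [Complex.normSq_apply]; ring
    have : ω ^ 2 + (((n + 1 : ℕ) : ℝ) + 1) ^ 2 ≠ 0 := by positivity
    rw [e1, e2]
    field_simp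
    exact ih

theorem normSq_legsW_le_one (n : ℕ) (ω : ℝ) : Complex.normSq (legsW n (ω * Complex.I)) ≤ 1 := by
  cases n with
  | zero => simp [legsW]
  | succ n =>
    have h := normSq_legsW_mul n ω
    have : (0 : ℝ) < ((n : ℝ) + 1) ^ 2 := by positivity
    nlinarith [sq_nonneg ω]

theorem legsW_ofReal_nonneg {n : ℕ} {T : ℝ} (hT : (n : ℝ) ≤ T) :
    ∃ r : ℝ, 0 ≤ r ∧ legsW n T = r := by
  refine ⟨∏ j ∈ Finset.range n, (T - j) / (T + (j + 1)), Finset.prod_nonneg fun j hj => ?_, ?_⟩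
  · have : (j : ℝ) ≤ n := by exact_mod_cast (Finset.mem_range.1 hj).le
    have h0 : (0 : ℝ) ≤ j := by positivity
    exact div_nonneg (by linarith) (by linarith)
  · simp [legsW]

/-- At frequency `ω`, the transfer functions `(iω - A)⁻¹ B` and `(iω - A⊥)⁻¹ B / 2` differ in the
coordinate `l` by at most `√(l + 1) / n` times the square root of `Re Bᵀ (iω - A⊥)⁻¹ B`. The latter
is bounded for `|ω| ≤ n`, where `|w|² ≤ 1 / 2` for `w = legsW n (iω)`. -/
theorem normSq_resolvent_sub_le {n : ℕ} (ω : ℝ) {x y : Fin n → ℂ}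
    (hx : (ω * Complex.I) • x - hippoA n *ᵥ x = hippoB n)
    (hy : (ω * Complex.I) • y - hippoAperp n *ᵥ y = hippoB n) (l : Fin n) :
    Complex.normSq (x l - 1 / 2 * y l)
        ≤ ((l : ℕ) + 1) / (n : ℝ) ^ 2 * (hippoB n ⬝ᵥ y).re ∧
      (|ω| ≤ n → (hippoB n ⬝ᵥ y).re ≤ 6) := by
  have hs : ∀ j : ℕ, (ω * Complex.I) + ((j : ℂ) + 1) ≠ 0 := by
    intro j h
    have := congrArg Complex.re h
    simp at this
    have h0 : (0 : ℝ) ≤ j := by positivity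
    linarith
  obtain ⟨hx1, -⟩ := hippoA_resolvent (c := 1) hs (by simpa using hx)
  obtain ⟨hy1, hy2⟩ := hippoAperp_resolvent hs hy
  set g := hippoB n ⬝ᵥ y with hg
  set w := legsW n (ω * Complex.I) with hw
  obtain ⟨m, rfl⟩ : ∃ m, n = m + 1 := ⟨n - 1, by have := l.2; omega⟩
  have hwn := normSq_legsW_mul m ω
  rw [← hw] at hwn
  have hn0 : (0 : ℝ) < ((m : ℝ) + 1) ^ 2 := by positivity
  have hpos : 0 < ω ^ 2 + ((m : ℝ) + 1) ^ 2 := by positivity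
  have hw1 : 1 - Complex.normSq w = ((m : ℝ) + 1) ^ 2 / (ω ^ 2 + ((m : ℝ) + 1) ^ 2) := by
    rw [eq_div_iff hpos.ne']; linarith
  have hwne : 1 + w ≠ 0 := by
    intro h
    have hw' : w = -1 := by linear_combination h
    rw [h, hw'] at hy2
    norm_num at hy2
  have hN : 0 < Complex.normSq (1 + w) := Complex.normSq_pos.2 hwne
  have hgw : g = (1 - w) / (1 + w) := by rw [eq_div_iff hwne]; exact hy2
  have hre : g.re * Complex.normSq (1 + w) = 1 - Complex.normSq w := by
    rw [hgw, Complex.div_re, add_mul, div_mul_cancel₀ _ hN.ne', div_mul_cancel₀ _ hN.ne']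
    simp [Complex.normSq_apply]
    ring
  have h1g : Complex.normSq (1 - g) * Complex.normSq (1 + w) = 4 * Complex.normSq w := by
    rw [← map_mul]
    have : (1 - g) * (1 + w) = 2 * w := by linear_combination -hy2
    rw [this, map_mul]
    norm_num [Complex.normSq_apply]
  -- Here `|1 - g|² = 4 |w|² / |1 + w|²` and `1 / |1 + w|² = Re g / (1 - |w|²)`.
  have hkey : Complex.normSq (1 - g) * ((m : ℝ) + 1) ^ 2 = 4 * (ω ^ 2 * g.re) := by
    have a : Complex.normSq w = ω ^ 2 / (ω ^ 2 + ((m : ℝ) + 1) ^ 2) := by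
      rw [eq_div_iff hpos.ne']; exact hwn
    rw [hw1] at hre
    rw [a] at h1g
    have hre' : g.re
        = ((m : ℝ) + 1) ^ 2 / (ω ^ 2 + ((m : ℝ) + 1) ^ 2) / Complex.normSq (1 + w) := by
      rw [eq_div_iff hN.ne']; exact hre
    have h1g' : Complex.normSq (1 - g)
        = 4 * (ω ^ 2 / (ω ^ 2 + ((m : ℝ) + 1) ^ 2)) / Complex.normSq (1 + w) := by
      rw [eq_div_iff hN.ne']; exact h1g
    rw [hre', h1g']
    field_simp
  refine ⟨?_, ?_⟩
  · have hdiff : x l - 1 / 2 * y l = x l * ((1 - g) / 2) := by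
      rw [hy1 l, hx1 l]; ring
    have hgre : 0 ≤ g.re := by
      have : 0 ≤ g.re * Complex.normSq (1 + w) := by rw [hre, hw1]; positivity
      exact nonneg_of_mul_nonneg_left this hN
    have hxl : Complex.normSq (x l) * ω ^ 2 ≤ (l : ℕ) + 1 := by
      have hB : Complex.normSq (hippoB (m + 1) l) = (2 * (l : ℕ) + 1) / 2 := by
        simp only [hippoB]
        rw [Complex.normSq_ofReal, Real.mul_self_sqrt (by positivity)]
      have hD : Complex.normSq ((ω * Complex.I) + (((l : ℕ) : ℂ) + 1))
          = ω ^ 2 + ((l : ℕ) + 1) ^ 2 := by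
        simp [Complex.normSq_apply]; ring
      have hl0 : (0 : ℝ) < ω ^ 2 + (((l : ℕ) : ℝ) + 1) ^ 2 := by positivity
      have hl1 : ω ^ 2 / (ω ^ 2 + (((l : ℕ) : ℝ) + 1) ^ 2) ≤ 1 := by
        rw [div_le_one hl0]; nlinarith [sq_nonneg (((l : ℕ) : ℝ) + 1)]
      rw [hx1 l, one_mul, Complex.normSq_mul, hB, map_div₀, hD]
      calc (2 * ((l : ℕ) : ℝ) + 1) / 2 * (Complex.normSq (legsW (l : ℕ) (ω * Complex.I))
              / (ω ^ 2 + (((l : ℕ) : ℝ) + 1) ^ 2)) * ω ^ 2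
          = (2 * ((l : ℕ) : ℝ) + 1) / 2 * (Complex.normSq (legsW (l : ℕ) (ω * Complex.I))
              * (ω ^ 2 / (ω ^ 2 + (((l : ℕ) : ℝ) + 1) ^ 2))) := by ring
        _ ≤ (2 * ((l : ℕ) : ℝ) + 1) / 2 * (1 * 1) := by
          have := normSq_legsW_le_one (l : ℕ) ω
          gcongr
        _ ≤ (l : ℕ) + 1 := by linarith
    have h2 : Complex.normSq (2 : ℂ) = 4 := by norm_num [Complex.normSq_apply]
    rw [hdiff, Complex.normSq_mul, map_div₀, h2]
    push_cast
    rw [div_mul_eq_mul_div, le_div_iff₀ hn0]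
    calc Complex.normSq (x l) * (Complex.normSq (1 - g) / 4) * ((m : ℝ) + 1) ^ 2
        = Complex.normSq (x l) * ω ^ 2 * g.re := by
          linear_combination Complex.normSq (x l) / 4 * hkey
      _ ≤ ((l : ℕ) + 1) * g.re := by gcongr
  · intro hω
    push_cast at hω
    have hω2 : ω ^ 2 ≤ ((m : ℝ) + 1) ^ 2 := sq_le_sq' (by linarith [neg_abs_le ω]) (by
      linarith [le_abs_self ω])
    have hws : ‖w‖ ^ 2 ≤ 1 / 2 := by
      rw [← Complex.normSq_eq_norm_sq]
      by_contra! hc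
      nlinarith
    have hw0 := norm_nonneg w
    have hwr : ‖w‖ ≤ 5 / 7 := by
      by_contra! hc
      nlinarith
    have htri : 1 - ‖w‖ ≤ ‖1 + w‖ := by
      simpa using norm_sub_norm_le (1 : ℂ) (-w)
    have hle : (1 - ‖w‖) ^ 2 ≤ ‖1 + w‖ ^ 2 := pow_le_pow_left₀ (by linarith) htri 2
    rw [Complex.normSq_eq_norm_sq, Complex.normSq_eq_norm_sq] at hre
    have hN' : 0 < ‖1 + w‖ ^ 2 := by rw [← Complex.normSq_eq_norm_sq]; exact hN
    -- `1 - r² ≤ 6 (1 - r)²` for `0 ≤ r ≤ 5 / 7`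
    refine le_of_mul_le_mul_right ?_ hN'
    rw [hre]
    nlinarith

/-! ### The spectral representation of `Bᵀ (s - A⊥)⁻¹ B` -/

theorem hippoAperp_add_conjTranspose (n : ℕ) : hippoAperp n + (hippoAperp n)ᴴ = -1 := by
  ext j k
  simp only [Matrix.add_apply, Matrix.conjTranspose_apply, hippoAperp, Matrix.neg_apply,
    Matrix.one_apply]
  rcases lt_trichotomy j k with h | h | h
  · simp [h.ne, h.ne', h, h.not_gt]
    ring
  · subst h
    simp
    norm_num
  · simp [h.ne, h.ne', h, h.not_gt]
    ring

namespace IsHippoDiagonalization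

variable {n : ℕ} {V : Matrix (Fin n) (Fin n) ℂ} {lam : Fin n → ℂ}

theorem inv_eq (h : IsHippoDiagonalization V lam) : V⁻¹ = Vᴴ :=
  Matrix.inv_eq_left_inv (Matrix.mem_unitaryGroup_iff'.1 h.unitary)

theorem conjTranspose_mul_self (h : IsHippoDiagonalization V lam) : Vᴴ * V = 1 :=
  Matrix.mem_unitaryGroup_iff'.1 h.unitary

theorem mul_conjTranspose_self (h : IsHippoDiagonalization V lam) : V * Vᴴ = 1 :=
  Matrix.mem_unitaryGroup_iff.1 h.unitary

theorem diagonal_eq (h : IsHippoDiagonalization V lam) :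
    Matrix.diagonal lam = Vᴴ * hippoAperp n * V := by
  rw [h.diagonalizes, h.inv_eq]
  calc Matrix.diagonal lam = 1 * Matrix.diagonal lam * 1 := by simp
    _ = Vᴴ * V * Matrix.diagonal lam * (Vᴴ * V) := by rw [h.conjTranspose_mul_self]
    _ = _ := by simp only [Matrix.mul_assoc]

theorem re_lam (h : IsHippoDiagonalization V lam) (k : Fin n) : (lam k).re = -1 / 2 := by
  have h1 : Matrix.diagonal lam + (Matrix.diagonal lam)ᴴ = -1 := by
    rw [h.diagonal_eq]
    simp only [Matrix.conjTranspose_mul, Matrix.conjTranspose_conjTranspose]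
    rw [← Matrix.mul_assoc, ← Matrix.add_mul, ← Matrix.mul_add, hippoAperp_add_conjTranspose]
    simp [h.conjTranspose_mul_self]
  have h2 := congrFun (congrFun h1 k) k
  simp at h2
  have h3 := congrArg Complex.re h2
  simp at h3
  linarith

/-- Partial fractions at the eigenvalues `-1/2 + i μ_k` of `A⊥`: the real part of
`Bᵀ (s - A⊥)⁻¹ B` is a sum of Poisson kernels with nonnegative weights. -/
theorem dotProduct_resolvent (h : IsHippoDiagonalization V lam) {s : ℂ} (hs : 0 ≤ s.re)
    {x : Fin n → ℂ} (hx : s • x - hippoAperp n *ᵥ x = hippoB n) :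
    (hippoB n ⬝ᵥ x).re = ∑ k, Complex.normSq ((Vᴴ *ᵥ hippoB n) k)
      * ((s.re + 1 / 2) / ((s.re + 1 / 2) ^ 2 + (s.im - (lam k).im) ^ 2)) := by
  set β := Vᴴ *ᵥ hippoB n with hβ
  set z := Vᴴ *ᵥ x with hz
  have h1 : ∀ k, (s - lam k) * z k = β k := by
    intro k
    have : s • z - Matrix.diagonal lam *ᵥ z = β := by
      rw [h.diagonal_eq, hβ, ← hx, hz, Matrix.mulVec_mulVec, Matrix.mul_assoc,
        h.mul_conjTranspose_self, Matrix.mul_one, Matrix.mulVec_sub, Matrix.mulVec_smul,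
        Matrix.mulVec_mulVec]
    have := congrFun this k
    simp [Matrix.mulVec_diagonal] at this
    linear_combination this
  have h2 : hippoB n ⬝ᵥ x = star β ⬝ᵥ z := by
    have hstar : star (hippoB n) = hippoB n := by
      ext j; simp [hippoB]
    rw [hβ, hz, Matrix.star_mulVec, Matrix.conjTranspose_conjTranspose, hstar,
      ← Matrix.dotProduct_mulVec, Matrix.mulVec_mulVec, h.mul_conjTranspose_self,
      Matrix.one_mulVec]
  rw [h2, dotProduct, Complex.re_sum]
  refine Finset.sum_congr rfl fun k _ => ?_
  have hk := h.re_lam k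
  have hre : (s - lam k).re = s.re + 1 / 2 := by rw [Complex.sub_re, hk]; ring
  have hne : s - lam k ≠ 0 := by
    intro h0
    rw [h0] at hre
    simp at hre
    linarith
  have hzk : z k = β k * (s - lam k)⁻¹ := by
    rw [← h1 k]; field_simp
  have : (star β) k * z k = (Complex.normSq (β k) : ℂ) * (s - lam k)⁻¹ := by
    rw [hzk, Complex.normSq_eq_conj_mul_self]
    simp [mul_assoc]
  rw [this, Complex.re_ofReal_mul, Complex.inv_re, hre, Complex.normSq_apply (s - lam k),
    hre, Complex.sub_im]
  ring_nf

theorem exists_resolvent (h : IsHippoDiagonalization V lam) {s : ℂ} (hs : 0 ≤ s.re) :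
    ∃ x : Fin n → ℂ, s • x - hippoAperp n *ᵥ x = hippoB n := by
  refine ⟨V *ᵥ fun k => (Vᴴ *ᵥ hippoB n) k / (s - lam k), ?_⟩
  have e : hippoAperp n = V * Matrix.diagonal lam * Vᴴ := by rw [h.diagonalizes, h.inv_eq]
  have e2 : s • (fun k => (Vᴴ *ᵥ hippoB n) k / (s - lam k))
      - Matrix.diagonal lam *ᵥ (fun k => (Vᴴ *ᵥ hippoB n) k / (s - lam k)) = Vᴴ *ᵥ hippoB n := by
    ext k
    have hk := h.re_lam k
    have hne : s - lam k ≠ 0 := by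
      intro h0
      have := congrArg Complex.re h0
      simp [hk] at this
      linarith
    simp only [Pi.sub_apply, Pi.smul_apply, smul_eq_mul, Matrix.mulVec_diagonal]
    field_simp
  rw [e, Matrix.mulVec_mulVec, Matrix.mul_assoc, h.conjTranspose_mul_self, Matrix.mul_one,
    ← Matrix.mulVec_mulVec, ← Matrix.mulVec_smul, ← Matrix.mulVec_sub, e2, Matrix.mulVec_mulVec,
    h.mul_conjTranspose_self, Matrix.one_mulVec]

/-- The positive harmonic function `Re Bᵀ (s - A⊥)⁻¹ B` is at most `1` at every real `s ≥ n`, because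
`legsW` is nonnegative there. -/
theorem sum_poisson_le_one (h : IsHippoDiagonalization V lam) {T : ℝ} (hT : (n : ℝ) ≤ T) :
    ∑ k, Complex.normSq ((Vᴴ *ᵥ hippoB n) k)
      * ((T + 1 / 2) / ((T + 1 / 2) ^ 2 + (lam k).im ^ 2)) ≤ 1 := by
  have hT0 : 0 ≤ T := le_trans (by positivity) hT
  obtain ⟨x, hx⟩ := h.exists_resolvent (s := T) (by simpa using hT0)
  have hs : ∀ j : ℕ, (T : ℂ) + ((j : ℂ) + 1) ≠ 0 := by
    intro j
    have : (0 : ℝ) < T + ((j : ℝ) + 1) := by positivity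
    exact_mod_cast this.ne'
  have h1 := h.dotProduct_resolvent (by simpa using hT0) hx
  obtain ⟨r, hr, hrw⟩ := legsW_ofReal_nonneg hT
  have h2 := (hippoAperp_resolvent hs hx).2
  rw [hrw] at h2
  have h3 := congrArg Complex.re h2
  simp at h3
  simp at h1
  simp only [one_div]
  rw [← h1]
  by_contra! hc
  nlinarith

end IsHippoDiagonalization

/-! ### Impulse responses -/

/-- The state `exp (t A) v` of the homogeneous system `x' = A x`, `x 0 = v`. -/
def expFlow {n : ℕ} (A : Matrix (Fin n) (Fin n) ℂ) (v : Fin n → ℂ) (t : ℝ) : Fin n → ℂ :=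
  NormedSpace.exp (t • A) *ᵥ v

/-- The numerical range of `A` lies in `Re z ≤ -1/2`. The sum on the right is the squared Euclidean
norm of `v`; the norm of `Fin n → ℂ` is the supremum norm. -/
def IsDissipative {n : ℕ} (A : Matrix (Fin n) (Fin n) ℂ) : Prop :=
  ∀ v : Fin n → ℂ, (star v ⬝ᵥ (A *ᵥ v)).re ≤ -(1 / 2) * ∑ i, Complex.normSq (v i)

theorem hippoAperp_dotProduct {n : ℕ} (v : Fin n → ℂ) :
    (star v ⬝ᵥ (hippoAperp n *ᵥ v)).re = -(1 / 2) * ∑ i, Complex.normSq (v i) := by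
  have h : star v ⬝ᵥ ((hippoAperp n + (hippoAperp n)ᴴ) *ᵥ v)
      = -((∑ i, Complex.normSq (v i) : ℝ) : ℂ) := by
    rw [hippoAperp_add_conjTranspose, Matrix.neg_mulVec, Matrix.one_mulVec, dotProduct_neg,
      dotProduct, Complex.ofReal_sum]
    simp [Complex.normSq_eq_conj_mul_self]
  have h2 : star v ⬝ᵥ ((hippoAperp n)ᴴ *ᵥ v) = star (star v ⬝ᵥ (hippoAperp n *ᵥ v)) := by
    rw [Matrix.dotProduct_mulVec, ← Matrix.star_mulVec, Matrix.star_dotProduct,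
      dotProduct_comm]
  rw [Matrix.add_mulVec, dotProduct_add, h2] at h
  have h3 := congrArg Complex.re h
  simp only [Complex.add_re, Complex.star_def, Complex.conj_re, Complex.neg_re,
    Complex.ofReal_re] at h3
  linarith

theorem isDissipative_hippoAperp (n : ℕ) : IsDissipative (hippoAperp n) :=
  fun v => (hippoAperp_dotProduct v).le

theorem isDissipative_hippoA (n : ℕ) : IsDissipative (hippoA n) := by
  intro v
  have hstar : star v ⬝ᵥ hippoB n = star (hippoB n ⬝ᵥ v) := by
    have hB : star (hippoB n) = hippoB n := by
      ext j; simp [hippoB]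
    rw [Matrix.star_dotProduct, hB]
  rw [hippoA_eq, Matrix.sub_mulVec, Matrix.vecMulVec_mulVec, dotProduct_sub, Complex.sub_re,
    hippoAperp_dotProduct]
  have : 0 ≤ (star v ⬝ᵥ (MulOpposite.op (hippoB n ⬝ᵥ v) • hippoB n)).re := by
    rw [dotProduct_smul, hstar]
    simp
    nlinarith [sq_nonneg (hippoB n ⬝ᵥ v).re, sq_nonneg (hippoB n ⬝ᵥ v).im]
  linarith

section

variable {n : ℕ} {A : Matrix (Fin n) (Fin n) ℂ} (v : Fin n → ℂ)

theorem hasDerivAt_expFlow (A : Matrix (Fin n) (Fin n) ℂ) (t : ℝ) :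
    HasDerivAt (expFlow A v) (A *ᵥ expFlow A v t) t := by
  let _ : NormedRing (Matrix (Fin n) (Fin n) ℂ) := Matrix.linftyOpNormedRing
  let _ : NormedAlgebra ℝ (Matrix (Fin n) (Fin n) ℂ) := Matrix.linftyOpNormedAlgebra
  let _ : NormedAlgebra ℚ (Matrix (Fin n) (Fin n) ℂ) := Matrix.linftyOpNormedAlgebra
  have hE := hasDerivAt_exp_smul_const' (𝕂 := ℝ) A t
  let L : Matrix (Fin n) (Fin n) ℂ →L[ℝ] (Fin n → ℂ) :=
    LinearMap.toContinuousLinearMap ((Matrix.mulVecBilin ℝ ℝ).flip v)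
  have h := L.hasFDerivAt.comp_hasDerivAt t hE
  refine h.congr_deriv ?_
  change (A * NormedSpace.exp (t • A)) *ᵥ v = _
  rw [expFlow, Matrix.mulVec_mulVec]

theorem continuous_expFlow (A : Matrix (Fin n) (Fin n) ℂ) : Continuous (expFlow A v) :=
  continuous_iff_continuousAt.2 fun t => (hasDerivAt_expFlow v A t).continuousAt

theorem expFlow_zero (A : Matrix (Fin n) (Fin n) ℂ) : expFlow A v 0 = v := by
  simp [expFlow]

/-- The squared Euclidean norm of the state decays like `exp (-t)`, by Grönwall's argument. -/
theorem IsDissipative.norm_expFlow_le (hA : IsDissipative A) {t : ℝ} (ht : 0 ≤ t) :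
    ‖expFlow A v t‖ ≤ √(∑ i, Complex.normSq (v i)) * Real.exp (-(1 / 2) * t) := by
  set N : ℝ → ℝ := fun t => ∑ i, Complex.normSq (expFlow A v t i) with hN
  have hderiv : ∀ t, HasDerivAt N
      (2 * (star (expFlow A v t) ⬝ᵥ (A *ᵥ expFlow A v t)).re) t := by
    intro t
    have h1 : ∀ i, HasDerivAt (fun t => Complex.normSq (expFlow A v t i))
        (2 * (star (expFlow A v t i) * (A *ᵥ expFlow A v t) i).re) t := by
      intro i
      have hi := (hasDerivAt_pi.1 (hasDerivAt_expFlow v A t)) i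
      have hr := Complex.reCLM.hasFDerivAt.comp_hasDerivAt t hi
      have him := Complex.imCLM.hasFDerivAt.comp_hasDerivAt t hi
      have h2 := (hr.mul hr).add (him.mul him)
      refine (h2.congr_of_eventuallyEq (Eventually.of_forall fun s => ?_)).congr_deriv ?_
      · simp [Complex.normSq_apply]
      · simp
        ring
    have h2 := HasDerivAt.fun_sum (u := Finset.univ) fun i _ => h1 i
    refine h2.congr_deriv ?_
    rw [dotProduct, Complex.re_sum, Finset.mul_sum]
    rfl
  have hanti : AntitoneOn (fun t => Real.exp t * N t) (Set.Ici 0) := by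
    have hd : ∀ t, HasDerivAt (fun t => Real.exp t * N t)
        (Real.exp t * N t
          + Real.exp t * (2 * (star (expFlow A v t) ⬝ᵥ (A *ᵥ expFlow A v t)).re)) t :=
      fun t => (Real.hasDerivAt_exp t).mul (hderiv t)
    refine antitoneOn_of_deriv_nonpos (convex_Ici 0)
      (fun t _ => (hd t).continuousAt.continuousWithinAt)
      (fun t _ => (hd t).differentiableAt.differentiableWithinAt) fun t _ => ?_
    rw [(hd t).deriv]
    have h1 := hA (expFlow A v t)
    have h2 := Real.exp_pos t
    have : N t + 2 * (star (expFlow A v t) ⬝ᵥ (A *ᵥ expFlow A v t)).re ≤ 0 := by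
      simp only [hN]; linarith
    nlinarith
  have h1 := hanti Set.self_mem_Ici (Set.mem_Ici.2 ht) ht
  simp only [Real.exp_zero, one_mul] at h1
  have hN0 : N 0 = ∑ i, Complex.normSq (v i) := by simp only [hN, expFlow_zero]
  rw [hN0] at h1
  rw [pi_norm_le_iff_of_nonneg (by positivity)]
  intro i
  have hi : ‖expFlow A v t i‖ ^ 2 ≤ N t := by
    rw [← Complex.normSq_eq_norm_sq]
    exact Finset.single_le_sum (f := fun i => Complex.normSq (expFlow A v t i))
      (fun j _ => Complex.normSq_nonneg _) (Finset.mem_univ i)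
  have hexp : Real.exp (-(1 / 2) * t) = √(Real.exp (-t)) := by
    rw [← Real.exp_half]; ring_nf
  rw [hexp, ← Real.sqrt_mul (Finset.sum_nonneg fun j _ => Complex.normSq_nonneg _)]
  refine Real.le_sqrt_of_sq_le (hi.trans ?_)
  rw [Real.exp_neg, ← div_eq_mul_inv, le_div_iff₀ (Real.exp_pos t), mul_comm]
  exact h1

theorem IsDissipative.integrable_laplace (hA : IsDissipative A) {z : ℂ} (hz : 0 ≤ z.re) :
    IntegrableOn (fun t : ℝ => Complex.exp (-z * t) • expFlow A v t) (Set.Ioi 0) := by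
  have hb : IntegrableOn (fun t : ℝ => √(∑ i, Complex.normSq (v i)) * Real.exp (-(1 / 2) * t))
      (Set.Ioi 0) := (exp_neg_integrableOn_Ioi 0 (by norm_num)).const_mul _
  have hc : Continuous fun t : ℝ => Complex.exp (-z * t) • expFlow A v t := by
    have := continuous_expFlow v A
    fun_prop
  refine Integrable.mono' hb hc.aestronglyMeasurable ?_
  refine (ae_restrict_iff' measurableSet_Ioi).2 (Eventually.of_forall fun t ht => ?_)
  have ht : 0 < t := ht
  rw [norm_smul, Complex.norm_exp]
  have h1 : (-z * t).re ≤ 0 := by simpa using mul_nonneg hz ht.le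
  have h2 := hA.norm_expFlow_le v ht.le
  exact (mul_le_of_le_one_left (norm_nonneg _) (Real.exp_le_one_iff.2 h1)).trans h2

/-- The Laplace transform of the flow inverts `z - A` on the closed right half plane. -/
theorem IsDissipative.laplace_eq (hA : IsDissipative A) {z : ℂ} (hz : 0 ≤ z.re) :
    z • (∫ t in Set.Ioi (0 : ℝ), Complex.exp (-z * t) • expFlow A v t)
      - A *ᵥ (∫ t in Set.Ioi (0 : ℝ), Complex.exp (-z * t) • expFlow A v t) = v := by
  have hint := hA.integrable_laplace v hz
  let L : (Fin n → ℂ) →L[ℂ] (Fin n → ℂ) := (Matrix.mulVecLin (A - z • 1)).toContinuousLinearMap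
  have hL : ∀ w, L w = A *ᵥ w - z • w := fun w => by
    change (A - z • 1) *ᵥ w = _
    rw [Matrix.sub_mulVec, Matrix.smul_mulVec, Matrix.one_mulVec]
  have hd : ∀ t : ℝ, HasDerivAt (fun t : ℝ => Complex.exp (-z * t) • expFlow A v t)
      (L (Complex.exp (-z * t) • expFlow A v t)) t := by
    intro t
    have h1 : HasDerivAt (fun t : ℝ => Complex.exp (-z * t)) (Complex.exp (-z * t) * (-z)) t := by
      have := ((hasDerivAt_id (t : ℂ)).const_mul (-z)).cexp.comp_ofReal
      simpa using this
    refine (h1.smul (hasDerivAt_expFlow v A t)).congr_deriv ?_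
    rw [hL, Matrix.mulVec_smul, smul_smul, sub_eq_add_neg, ← neg_smul, mul_neg,
      mul_comm z]
  have hlim : Tendsto (fun t : ℝ => Complex.exp (-z * t) • expFlow A v t) atTop (𝓝 0) := by
    have hb : Tendsto (fun t : ℝ => √(∑ i, Complex.normSq (v i)) * Real.exp (-(1 / 2) * t)) atTop
        (𝓝 0) := by
      have : Tendsto (fun t : ℝ => Real.exp (-(1 / 2) * t)) atTop (𝓝 0) :=
        Real.tendsto_exp_atBot.comp (tendsto_id.const_mul_atTop_of_neg (by norm_num))
      simpa using this.const_mul (√(∑ i, Complex.normSq (v i)))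
    refine squeeze_zero_norm' ?_ hb
    filter_upwards [eventually_ge_atTop 0] with t ht
    rw [norm_smul, Complex.norm_exp]
    have h1 : (-z * t).re ≤ 0 := by simpa using mul_nonneg hz ht
    have h2 := hA.norm_expFlow_le v ht
    exact (mul_le_of_le_one_left (norm_nonneg _) (Real.exp_le_one_iff.2 h1)).trans h2
  have h := integral_Ioi_of_hasDerivAt_of_tendsto' (fun t _ => hd t) (L.integrable_comp hint) hlim
  rw [L.integral_comp_comm hint, hL] at h
  simp only [Complex.ofReal_zero, mul_zero, Complex.exp_zero, one_smul, expFlow_zero,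
    zero_sub] at h
  rw [← neg_sub, h, neg_neg]

/-- The causal impulse response of the `l`-th state. -/
def impulse (A : Matrix (Fin n) (Fin n) ℂ) (v : Fin n → ℂ) (l : Fin n) : ℝ → ℂ :=
  (Set.Ici 0).indicator fun t => expFlow A v t l

theorem IsDissipative.norm_expFlow_apply_le (hA : IsDissipative A) (l : Fin n) {t : ℝ}
    (ht : 0 ≤ t) :
    ‖expFlow A v t l‖ ≤ √(∑ i, Complex.normSq (v i)) * Real.exp (-(1 / 2) * t) :=
  (norm_le_pi_norm _ l).trans (hA.norm_expFlow_le v ht)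

theorem IsDissipative.integrable_impulse (hA : IsDissipative A) (l : Fin n) :
    Integrable (impulse A v l) := by
  rw [impulse, integrable_indicator_iff measurableSet_Ici, integrableOn_Ici_iff_integrableOn_Ioi]
  have hb : IntegrableOn (fun t : ℝ => √(∑ i, Complex.normSq (v i)) * Real.exp (-(1 / 2) * t))
      (Set.Ioi 0) := (exp_neg_integrableOn_Ioi 0 (by norm_num)).const_mul _
  refine Integrable.mono' hb
    ((continuous_apply l).comp (continuous_expFlow v A)).aestronglyMeasurable ?_
  exact (ae_restrict_iff' measurableSet_Ioi).2 (Eventually.of_forall fun t ht =>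
    hA.norm_expFlow_apply_le v l (le_of_lt ht))

theorem IsDissipative.norm_impulse_le (hA : IsDissipative A) (l : Fin n) (t : ℝ) :
    ‖impulse A v l t‖ ≤ √(∑ i, Complex.normSq (v i)) := by
  by_cases ht : 0 ≤ t
  · rw [impulse, Set.indicator_of_mem (Set.mem_Ici.2 ht)]
    refine (hA.norm_expFlow_apply_le v l ht).trans (mul_le_of_le_one_right (by positivity) ?_)
    exact Real.exp_le_one_iff.2 (by linarith)
  · rw [impulse, Set.indicator_of_notMem (by simpa using ht), norm_zero]
    positivity

theorem IsDissipative.memLp_impulse (hA : IsDissipative A) (l : Fin n) :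
    MemLp (impulse A v l) 2 := by
  have h1 := hA.integrable_impulse v l
  refine (memLp_two_iff_integrable_sq_norm h1.1).2 ?_
  refine Integrable.mono' (h1.norm.const_mul (√(∑ i, Complex.normSq (v i)))) (h1.1.norm.pow 2)
    (Eventually.of_forall fun t => ?_)
  rw [norm_pow, norm_norm, sq]
  gcongr
  exact hA.norm_impulse_le v l t

/-- The transfer function is the Fourier integral of the impulse response. -/
theorem IsDissipative.fourier_impulse (hA : IsDissipative A) (l : Fin n) (ξ : ℝ) :
    𝓕 (impulse A v l) ξ = (∫ t in Set.Ioi (0 : ℝ),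
      Complex.exp (-(((2 * Real.pi * ξ : ℝ) : ℂ) * Complex.I) * t) • expFlow A v t) l := by
  have hint := hA.integrable_laplace v (z := ((2 * Real.pi * ξ : ℝ) : ℂ) * Complex.I) (by simp)
  have h := (ContinuousLinearMap.proj (R := ℂ) (φ := fun _ : Fin n => ℂ) l).integral_comp_comm hint
  simp only [ContinuousLinearMap.proj_apply] at h
  rw [← h, Real.fourier_real_eq_integral_exp_smul, ← integral_Ici_eq_integral_Ioi,
    ← integral_indicator measurableSet_Ici]
  refine integral_congr_ae (Eventually.of_forall fun t => ?_)
  by_cases ht : t ∈ Set.Ici (0 : ℝ)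
  · simp only [impulse, Set.indicator_of_mem ht, Pi.smul_apply, smul_eq_mul]
    congr 2
    push_cast
    ring
  · simp [impulse, Set.indicator_of_notMem ht]

/-- The output of a system in the coordinates given by `V` is the convolution of the input with the
impulse response, plus the feedthrough. -/
theorem IsDissipative.output_eq (hA : IsDissipative A) {V : Matrix (Fin n) (Fin n) ℂ}
    (hV : IsUnit V) (l : Fin n) (D : ℂ) {u : ℝ → ℂ} (hu : MemLp u 2) (t : ℝ) :
    LTISystem.output ⟨V⁻¹ * A * V, V⁻¹ *ᵥ v, Pi.single l 1 ᵥ* V, D⟩ u t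
      = (∫ τ, u τ * impulse A v l (t - τ)) + D * u t := by
  have hVV : V * V⁻¹ = 1 := Matrix.mul_nonsing_inv V ((Matrix.isUnit_iff_isUnit_det V).1 hV)
  have hmp := Measure.measurePreserving_sub_left (volume : Measure ℝ) t
  have hint : ∀ i, Integrable fun τ => u τ * impulse A v i (t - τ) := fun i =>
    hu.integrable_mul ((hA.memLp_impulse v i).comp_measurePreserving hmp)
  have himp : ∀ i, (fun τ => u τ * impulse A v i (t - τ))
      = (Set.Iic t).indicator fun τ => (u τ • expFlow A v (t - τ)) i := by
    intro i
    ext τ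
    by_cases h : τ ≤ t
    · rw [impulse, Set.indicator_of_mem (by simpa using h), Set.indicator_of_mem (by simpa using h)]
      rfl
    · rw [impulse, Set.indicator_of_notMem (by simpa using h),
        Set.indicator_of_notMem (by simpa using h), mul_zero]
  have hvec : IntegrableOn (fun τ => u τ • expFlow A v (t - τ)) (Set.Iic t) := by
    refine Integrable.of_eval fun i => ?_
    have := hint i
    rw [himp i, integrable_indicator_iff measurableSet_Iic] at this
    exact this
  let L : (Fin n → ℂ) →L[ℂ] (Fin n → ℂ) := (Matrix.mulVecLin V⁻¹).toContinuousLinearMap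
  have hL : ∀ w, L w = V⁻¹ *ᵥ w := fun _ => rfl
  have hflow : ∀ τ, u τ • (NormedSpace.exp ((t - τ) • (V⁻¹ * A * V)) *ᵥ (V⁻¹ *ᵥ v))
      = L (u τ • expFlow A v (t - τ)) := by
    intro τ
    have : (t - τ) • (V⁻¹ * A * V) = V⁻¹ * ((t - τ) • A) * V := by
      rw [Matrix.mul_smul, Matrix.smul_mul]
    rw [this, Matrix.exp_conj' _ _ hV, hL, Matrix.mulVec_smul, expFlow, Matrix.mulVec_mulVec,
      Matrix.mulVec_mulVec, Matrix.mul_assoc, hVV, Matrix.mul_one]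
  have hstate : LTISystem.state ⟨V⁻¹ * A * V, V⁻¹ *ᵥ v, Pi.single l 1 ᵥ* V, D⟩ u t
      = V⁻¹ *ᵥ ∫ τ in Set.Iic t, u τ • expFlow A v (t - τ) := by
    rw [LTISystem.state]
    simp only [hflow]
    rw [L.integral_comp_comm hvec, hL]
  have hproj := (ContinuousLinearMap.proj (R := ℂ) (φ := fun _ : Fin n => ℂ) l).integral_comp_comm
    hvec
  simp only [ContinuousLinearMap.proj_apply] at hproj
  rw [LTISystem.output, hstate]
  simp only
  rw [← Matrix.dotProduct_mulVec, Matrix.mulVec_mulVec, hVV, Matrix.one_mulVec,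
    single_one_dotProduct, ← hproj, himp l, integral_indicator measurableSet_Iic]

end

/-! ### An integral estimate for sums of Poisson kernels -/

/-- `π` times the Poisson kernel of the half plane `Re z > -1/2`, evaluated on the imaginary axis,
that is, at distance `1/2` from the boundary. -/
def halfPoisson (x : ℝ) : ℝ := (1 / 2) / ((1 / 2) ^ 2 + x ^ 2)

theorem halfPoisson_nonneg (x : ℝ) : 0 ≤ halfPoisson x := by unfold halfPoisson; positivity

theorem continuous_halfPoisson : Continuous halfPoisson := by
  unfold halfPoisson
  refine continuous_const.div (by fun_prop) fun x => by positivity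

theorem halfPoisson_eq (x : ℝ) : halfPoisson x = 2 * (1 + (2 * x) ^ 2)⁻¹ := by
  unfold halfPoisson
  field_simp

theorem integrable_halfPoisson : Integrable halfPoisson := by
  have h := (integrable_inv_one_add_sq.comp_mul_left' (two_ne_zero (α := ℝ))).const_mul 2
  exact h.congr (Eventually.of_forall fun x => (halfPoisson_eq x).symm)

theorem integral_halfPoisson : ∫ x, halfPoisson x = Real.pi := by
  simp only [halfPoisson_eq]
  rw [integral_const_mul, Measure.integral_comp_mul_left (fun y : ℝ => (1 + y ^ 2)⁻¹) 2,
    integral_univ_inv_one_add_sq]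
  norm_num [abs_of_pos]
  ring

/-- The mass that a Poisson kernel puts on `[-2 T, 2 T]` is, uniformly in its centre `μ`, at most a
multiple of `T` times its value at the real point `T`. -/
theorem setIntegral_halfPoisson_le {T : ℝ} (hT : 1 ≤ T) (μ : ℝ) :
    ∫ ω in Set.Icc (-(2 * T)) (2 * T), halfPoisson (ω - μ)
      ≤ 75 * T * ((T + 1 / 2) / ((T + 1 / 2) ^ 2 + μ ^ 2)) := by
  have hint : Integrable fun ω => halfPoisson (ω - μ) := integrable_halfPoisson.comp_sub_right μ
  have hone : IntegrableOn (fun _ : ℝ => (1 : ℝ)) (Set.Icc (-(2 * T)) (2 * T)) :=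
    continuous_const.integrableOn_Icc
  set I := ∫ ω in Set.Icc (-(2 * T)) (2 * T), halfPoisson (ω - μ) with hI
  have hIpi : I ≤ Real.pi := by
    rw [← integral_halfPoisson, ← integral_sub_right_eq_self halfPoisson μ]
    exact setIntegral_le_integral hint (Eventually.of_forall fun ω => halfPoisson_nonneg _)
  have h1 : (μ ^ 2 + T ^ 2) * I ≤ 33 * T ^ 2 := by
    have h2 : (μ ^ 2 + T ^ 2) * I ≤ ∫ ω in Set.Icc (-(2 * T)) (2 * T),
        (1 + 9 * T ^ 2 * halfPoisson (ω - μ)) := by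
      rw [hI, ← integral_const_mul]
      refine setIntegral_mono_on (hint.const_mul _).integrableOn
        (hone.add (hint.const_mul _).integrableOn) measurableSet_Icc
        fun ω hω => ?_
      have hω2 : ω ^ 2 ≤ 4 * T ^ 2 := by
        have := sq_le_sq' hω.1 hω.2
        linarith
      -- `μ² ≤ 2 (ω - μ)² + 2 ω²`
      have h3 : μ ^ 2 + T ^ 2 ≤ 2 * (ω - μ) ^ 2 + 9 * T ^ 2 := by
        nlinarith [sq_nonneg (2 * ω - μ)]
      have h4 : 2 * (ω - μ) ^ 2 * halfPoisson (ω - μ) ≤ 1 := by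
        rw [halfPoisson, ← mul_div_assoc, div_le_one (by positivity)]
        nlinarith
      nlinarith [mul_le_mul_of_nonneg_right h3 (halfPoisson_nonneg (ω - μ))]
    rw [integral_add hone (hint.const_mul _).integrableOn,
      integral_const_mul, ← hI] at h2
    simp at h2
    have hpi := Real.pi_lt_d2
    rw [max_eq_left (by linarith)] at h2
    nlinarith [mul_le_mul_of_nonneg_left hIpi (sq_nonneg T)]
  have hpos : 0 < μ ^ 2 + T ^ 2 := by positivity
  have hI0 : 0 ≤ I := setIntegral_nonneg measurableSet_Icc fun ω _ => halfPoisson_nonneg _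
  rw [← mul_div_assoc, le_div_iff₀ (by positivity)]
  have h5 : (T + 1 / 2) ^ 2 + μ ^ 2 ≤ 9 / 4 * (μ ^ 2 + T ^ 2) := by nlinarith [sq_nonneg μ]
  nlinarith [mul_le_mul_of_nonneg_left h5 hI0]

/-- If a sum of Poisson kernels with nonnegative weights is at most `1` at all real points `T ≥ n`,
then its boundary values have bounded mean over `[-2 T, 2 T]`, so that they are integrable against
`|ω| ^ (-2 q)`, `q > 1/2`, on `|ω| ≥ n`. -/
theorem lintegral_poisson_le {ι : Type*} [Fintype ι] {n : ℕ} (hn : 1 ≤ n) {c μ : ι → ℝ}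
    (hc : ∀ k, 0 ≤ c k)
    (H : ∀ T : ℝ, (n : ℝ) ≤ T → ∑ k, c k * ((T + 1 / 2) / ((T + 1 / 2) ^ 2 + μ k ^ 2)) ≤ 1)
    {q : ℝ} (hq : 1 / 2 < q) :
    ∫⁻ ω in {ω : ℝ | (n : ℝ) ≤ |ω|},
        ENNReal.ofReal ((∑ k, c k * halfPoisson (ω - μ k)) * (|ω| ^ (-q)) ^ 2)
      ≤ ENNReal.ofReal (75 / (1 - 2 ^ (1 - 2 * q))) := by
  have hn1 : (1 : ℝ) ≤ n := by exact_mod_cast hn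
  set P : ℝ → ℝ := fun ω => ∑ k, c k * halfPoisson (ω - μ k) with hP
  have hP0 : ∀ ω, 0 ≤ P ω := fun ω =>
    Finset.sum_nonneg fun k _ => mul_nonneg (hc k) (halfPoisson_nonneg _)
  have hPint : Integrable P := integrable_finsetSum _ fun k _ =>
    (integrable_halfPoisson.comp_sub_right (μ k)).const_mul (c k)
  have hmean : ∀ T : ℝ, (n : ℝ) ≤ T →
      ∫⁻ ω in Set.Icc (-(2 * T)) (2 * T), ENNReal.ofReal (P ω) ≤ ENNReal.ofReal (75 * T) := by
    intro T hT
    rw [← ofReal_integral_eq_lintegral_ofReal hPint.integrableOn (Eventually.of_forall hP0)]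
    refine ENNReal.ofReal_le_ofReal ?_
    rw [hP, integral_finsetSum _ fun k _ =>
      ((integrable_halfPoisson.comp_sub_right (μ k)).const_mul (c k)).integrableOn]
    simp only [integral_const_mul]
    calc ∑ k, c k * ∫ ω in Set.Icc (-(2 * T)) (2 * T), halfPoisson (ω - μ k)
        ≤ ∑ k, c k * (75 * T * ((T + 1 / 2) / ((T + 1 / 2) ^ 2 + μ k ^ 2))) := by
          gcongr with k
          · exact hc k
          · exact setIntegral_halfPoisson_le (hn1.trans hT) _
      _ = 75 * T * ∑ k, c k * ((T + 1 / 2) / ((T + 1 / 2) ^ 2 + μ k ^ 2)) := by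
          rw [Finset.mul_sum]
          exact Finset.sum_congr rfl fun k _ => by ring
      _ ≤ 75 * T * 1 := by
          have := H T hT
          have : 0 ≤ T := by linarith
          gcongr
      _ = 75 * T := mul_one _
  set r : ℝ := 2 ^ (1 - 2 * q) with hr
  have hr0 : 0 < r := by positivity
  have hr1 : r < 1 := Real.rpow_lt_one_of_one_lt_of_neg one_lt_two (by linarith)
  -- dyadic shells, on which `|ω| ^ (-q)` varies by a bounded factor
  set A : ℕ → Set ℝ := fun j => {ω | 2 ^ j * (n : ℝ) ≤ |ω| ∧ |ω| ≤ 2 * (2 ^ j * n)} with hA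
  have hcover : {ω : ℝ | (n : ℝ) ≤ |ω|} ⊆ ⋃ j, A j := by
    intro ω hω
    have hω : (n : ℝ) ≤ |ω| := hω
    obtain ⟨j, hj1, hj2⟩ := exists_nat_pow_near (x := |ω| / n) (y := 2)
      ((one_le_div (by linarith)).2 hω) one_lt_two
    rw [le_div_iff₀ (by linarith)] at hj1
    rw [div_lt_iff₀ (by linarith), pow_succ] at hj2
    exact Set.mem_iUnion.2 ⟨j, hj1, by linarith⟩
  have hshell : ∀ j, ∫⁻ ω in A j, ENNReal.ofReal (P ω * (|ω| ^ (-q)) ^ 2)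
      ≤ ENNReal.ofReal (75 * r ^ j) := by
    intro j
    set T : ℝ := 2 ^ j * n with hT
    have hTn : (n : ℝ) ≤ T := le_mul_of_one_le_left (by linarith) (one_le_pow₀ one_le_two)
    have hT0 : 0 < T := by linarith
    have hTq : (T ^ (-q)) ^ 2 * T ≤ r ^ j := by
      have e1 : (T ^ (-q)) ^ 2 * T = T ^ (1 - 2 * q) := by
        rw [← Real.rpow_natCast, ← Real.rpow_mul hT0.le, ← Real.rpow_add_one hT0.ne']
        congr 1
        push_cast
        ring
      have e2 : r ^ j = ((2 : ℝ) ^ j) ^ (1 - 2 * q) := by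
        rw [hr, ← Real.rpow_natCast, ← Real.rpow_natCast, ← Real.rpow_mul two_pos.le,
          ← Real.rpow_mul two_pos.le, mul_comm]
      rw [e1, e2]
      refine Real.rpow_le_rpow_of_nonpos (by positivity) ?_ (by linarith)
      exact le_mul_of_one_le_right (by positivity) hn1
    calc ∫⁻ ω in A j, ENNReal.ofReal (P ω * (|ω| ^ (-q)) ^ 2)
        ≤ ∫⁻ ω in A j, ENNReal.ofReal ((T ^ (-q)) ^ 2) * ENNReal.ofReal (P ω) := by
          have hmeas : MeasurableSet (A j) :=
            (measurableSet_le measurable_const measurable_abs).inter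
              (measurableSet_le measurable_abs measurable_const)
          refine setLIntegral_mono' hmeas fun ω hω => ?_
          rw [← ENNReal.ofReal_mul (by positivity), mul_comm]
          refine ENNReal.ofReal_le_ofReal ?_
          have := hP0 ω
          have := Real.rpow_le_rpow_of_nonpos hT0 hω.1 (show -q ≤ 0 by linarith)
          gcongr
      _ = ENNReal.ofReal ((T ^ (-q)) ^ 2) * ∫⁻ ω in A j, ENNReal.ofReal (P ω) :=
          lintegral_const_mul' _ _ ENNReal.ofReal_ne_top
      _ ≤ ENNReal.ofReal ((T ^ (-q)) ^ 2) * ENNReal.ofReal (75 * T) := by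
          gcongr
          refine (lintegral_mono_set fun ω hω => ?_).trans (hmean T hTn)
          exact abs_le.1 hω.2
      _ = ENNReal.ofReal (75 * ((T ^ (-q)) ^ 2 * T)) := by
          rw [← ENNReal.ofReal_mul (by positivity)]
          congr 1
          ring
      _ ≤ ENNReal.ofReal (75 * r ^ j) := by gcongr
  calc _ ≤ ∫⁻ ω in ⋃ j, A j, ENNReal.ofReal (P ω * (|ω| ^ (-q)) ^ 2) := lintegral_mono_set hcover
    _ ≤ ∑' j, ∫⁻ ω in A j, ENNReal.ofReal (P ω * (|ω| ^ (-q)) ^ 2) := lintegral_iUnion_le _ _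
    _ ≤ ∑' j, ENNReal.ofReal (75 * r ^ j) := ENNReal.tsum_le_tsum hshell
    _ = ENNReal.ofReal (75 / (1 - r)) := by
      rw [← ENNReal.ofReal_tsum_of_nonneg (fun j => by positivity)
        ((summable_geometric_of_lt_one hr0.le hr1).mul_left 75), tsum_mul_left,
        tsum_geometric_of_lt_one hr0.le hr1, div_eq_mul_inv]

/-! ### The error of the diagonal initialization -/

/-- The impulse response of the difference of the two systems. The feedthrough `D` cancels, and the
diagonalization does not enter. -/
def impulseDiff (n : ℕ) (l : Fin n) (t : ℝ) : ℂ :=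
  impulse (hippoA n) (hippoB n) l t - 1 / 2 * impulse (hippoAperp n) (hippoB n) l t

theorem integrable_impulseDiff {n : ℕ} (l : Fin n) : Integrable (impulseDiff n l) :=
  ((isDissipative_hippoA n).integrable_impulse _ l).sub
    (((isDissipative_hippoAperp n).integrable_impulse _ l).const_mul _)

theorem memLp_impulseDiff {n : ℕ} (l : Fin n) : MemLp (impulseDiff n l) 2 :=
  ((isDissipative_hippoA n).memLp_impulse _ l).sub
    (((isDissipative_hippoAperp n).memLp_impulse _ l).const_mul _)

theorem impulse_smul {n : ℕ} (A : Matrix (Fin n) (Fin n) ℂ) (v : Fin n → ℂ) (c : ℂ) (l : Fin n)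
    (t : ℝ) : impulse A (c • v) l t = c * impulse A v l t := by
  by_cases ht : t ∈ Set.Ici (0 : ℝ)
  · simp [impulse, Set.indicator_of_mem ht, expFlow, Matrix.mulVec_smul]
  · simp [impulse, Set.indicator_of_notMem ht]

namespace IsHippoDiagonalization

variable {n : ℕ} {V : Matrix (Fin n) (Fin n) ℂ} {lam : Fin n → ℂ}

theorem output_sub_output (h : IsHippoDiagonalization V lam) (l : Fin n) (D : ℂ)
    {u : ℝ → ℂ} (hu : MemLp u 2) (t : ℝ) :
    (sysDPLR V lam l D).output u t - (sysDiag V lam l D).output u t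
      = ∫ τ, u τ * impulseDiff n l (t - τ) := by
  have hV : IsUnit V := IsUnit.of_mul_eq_one _ h.mul_conjTranspose_self
  have hdiag : Matrix.diagonal lam = V⁻¹ * hippoAperp n * V := by rw [h.diagonal_eq, h.inv_eq]
  have h1 : sysDPLR V lam l D
      = ⟨V⁻¹ * hippoA n * V, V⁻¹ *ᵥ hippoB n, Pi.single l 1 ᵥ* V, D⟩ := by
    rw [sysDPLR, hdiag, hippoA_eq, Matrix.mul_sub, Matrix.sub_mul]
  have h2 : sysDiag V lam l D
      = ⟨V⁻¹ * hippoAperp n * V, V⁻¹ *ᵥ ((1 / 2 : ℂ) • hippoB n), Pi.single l 1 ᵥ* V, D⟩ := by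
    rw [sysDiag, hdiag, Matrix.mulVec_smul]
  have hmp := Measure.measurePreserving_sub_left (volume : Measure ℝ) t
  have hi1 : Integrable fun τ => u τ * impulse (hippoA n) (hippoB n) l (t - τ) :=
    hu.integrable_mul (((isDissipative_hippoA n).memLp_impulse _ l).comp_measurePreserving hmp)
  have hi2 : Integrable fun τ =>
      u τ * impulse (hippoAperp n) ((1 / 2 : ℂ) • hippoB n) l (t - τ) :=
    hu.integrable_mul (((isDissipative_hippoAperp n).memLp_impulse _ l).comp_measurePreserving hmp)
  rw [h1, h2, (isDissipative_hippoA n).output_eq _ hV l D hu,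
    (isDissipative_hippoAperp n).output_eq _ hV l D hu, add_sub_add_right_eq_sub,
    ← integral_sub hi1 hi2]
  simp only [impulseDiff, impulse_smul, mul_sub]

/-- The frequency response of the difference of the two systems is controlled by the boundary
values of a positive harmonic function. -/
theorem norm_fourier_impulseDiff_sq_le (h : IsHippoDiagonalization V lam) (l : Fin n) (ξ : ℝ) :
    ‖𝓕 (impulseDiff n l) ξ‖ ^ 2 ≤ ((l : ℕ) + 1) / (n : ℝ) ^ 2 *
        ∑ k, Complex.normSq ((Vᴴ *ᵥ hippoB n) k)
          * halfPoisson (2 * Real.pi * ξ - (lam k).im) ∧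
      (|2 * Real.pi * ξ| ≤ n → ∑ k, Complex.normSq ((Vᴴ *ᵥ hippoB n) k)
          * halfPoisson (2 * Real.pi * ξ - (lam k).im) ≤ 6) := by
  set ω := 2 * Real.pi * ξ with hω
  have hre : (0 : ℝ) ≤ ((ω : ℂ) * Complex.I).re := by simp
  have hA := isDissipative_hippoA n
  have hP := isDissipative_hippoAperp n
  have hx := hA.laplace_eq (hippoB n) hre
  have hy := hP.laplace_eq (hippoB n) hre
  have hF : 𝓕 (impulseDiff n l) ξ
      = 𝓕 (impulse (hippoA n) (hippoB n) l) ξ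
        - 1 / 2 * 𝓕 (impulse (hippoAperp n) (hippoB n) l) ξ := by
    have hi1 := (Real.fourierIntegral_convergent_iff ξ).2 (hA.integrable_impulse (hippoB n) l)
    have hi2 := (Real.fourierIntegral_convergent_iff ξ).2 (hP.integrable_impulse (hippoB n) l)
    rw [Real.fourier_eq, Real.fourier_eq, Real.fourier_eq, ← integral_const_mul,
      ← integral_sub hi1 (hi2.const_mul _)]
    refine integral_congr_ae (Eventually.of_forall fun t => ?_)
    simp only [impulseDiff, Circle.smul_def, smul_eq_mul]
    ring
  have hs : ∑ k, Complex.normSq ((Vᴴ *ᵥ hippoB n) k) * halfPoisson (ω - (lam k).im)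
      = (hippoB n ⬝ᵥ ∫ t in Set.Ioi (0 : ℝ),
        Complex.exp (-((ω : ℂ) * Complex.I) * t) • expFlow (hippoAperp n) (hippoB n) t).re := by
    rw [h.dotProduct_resolvent hre hy]
    simp [halfPoisson]
  rw [hs, ← Complex.normSq_eq_norm_sq, hF, hA.fourier_impulse, hP.fourier_impulse]
  exact normSq_resolvent_sub_le ω hx hy l

end IsHippoDiagonalization

theorem quasiMeasurePreserving_two_pi_mul :
    Measure.QuasiMeasurePreserving (fun ξ : ℝ => 2 * Real.pi * ξ) := by
  refine ⟨by fun_prop, ?_⟩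
  rw [Real.map_volume_mul_left (by positivity)]
  exact Measure.smul_absolutelyContinuous

theorem lintegral_comp_two_pi_mul_le (f : ℝ → ℝ≥0∞) (hf : Measurable f) :
    ∫⁻ ξ, f (2 * Real.pi * ξ) ≤ ∫⁻ ω, f ω := by
  rw [← lintegral_map hf (by fun_prop : Measurable fun ξ : ℝ => 2 * Real.pi * ξ),
    Real.map_volume_mul_left (by positivity), lintegral_smul_measure, smul_eq_mul]
  refine mul_le_of_le_one_left zero_le ?_
  rw [ENNReal.ofReal_le_one, abs_inv, abs_of_pos (by positivity)]
  exact inv_le_one_of_one_le₀ (by linarith [Real.pi_gt_three])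

theorem mainTheorem1 (q' : ℝ) (hq' : 1 / 2 < q') (K : ℝ) (hK : 0 < K) :
      ∃ M : ℝ, 0 < M ∧
        ∀ s₀ : ℝ, ∃ N : ℕ,
          ∀ (q : ℝ) (u : Lp ℂ 2 (volume : Measure ℝ)),
            q' ≤ q → ‖u‖ = 1 →
            (∀ᵐ s : ℝ, s₀ ≤ |s| → ‖angularFourier u s‖ ≤ K * |s| ^ (-q)) →
            ∀ n : ℕ, N ≤ n →
            ∀ (V : Matrix (Fin n) (Fin n) ℂ) (lam : Fin n → ℂ), IsHippoDiagonalization V lam →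
            ∀ (l : Fin n) (D : ℂ),
              MemLp (fun t => (sysDPLR V lam l D).output u t - (sysDiag V lam l D).output u t)
                2 volume ∧
              eLpNorm (fun t => (sysDPLR V lam l D).output u t - (sysDiag V lam l D).output u t)
                2 volume ≤ ENNReal.ofReal (M * (n : ℝ)⁻¹ * √((l : ℕ) + 1)) := by
  set R : ℝ := 75 / (1 - 2 ^ (1 - 2 * q')) with hR
  have hR0 : 0 < R := by
    have := Real.rpow_lt_one_of_one_lt_of_neg one_lt_two (show 1 - 2 * q' < 0 by linarith)
    exact div_pos (by norm_num) (by linarith)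
  -- `6` bounds the contribution of `|ω| ≤ n`, and `K ^ 2 * R` that of `|ω| ≥ n`.
  refine ⟨√(6 + K ^ 2 * R), by positivity, fun s₀ => ⟨max 1 ⌈s₀⌉₊, ?_⟩⟩
  -- `n ≥ s₀` makes the decay available for `|ω| ≥ n`, and `n ≥ 1` reduces it to the exponent `q'`.
  intro q u hq hu hdecay n hn V lam h l D
  have hn1 : 1 ≤ n := (le_max_left _ _).trans hn
  have hn1' : (1 : ℝ) ≤ n := by exact_mod_cast hn1
  have hns : s₀ ≤ n := (Nat.le_ceil s₀).trans (by exact_mod_cast (le_max_right _ _).trans hn)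
  have hout : (fun t => (sysDPLR V lam l D).output u t - (sysDiag V lam l D).output u t)
      = fun t => ∫ τ, u τ * impulseDiff n l (t - τ) := by
    ext t
    exact h.output_sub_output l D (Lp.memLp u) t
  obtain ⟨hmem, hnorm⟩ := eLpNorm_convolution_eq (integrable_impulseDiff l) (memLp_impulseDiff l) u
  rw [hout, hnorm]
  refine ⟨hmem, ?_⟩
  set U : Lp ℂ 2 (volume : Measure ℝ) := 𝓕 u with hU
  set P : ℝ → ℝ := fun ω => ∑ k, Complex.normSq ((Vᴴ *ᵥ hippoB n) k)
    * halfPoisson (ω - (lam k).im) with hP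
  have hP0 : ∀ ω, 0 ≤ P ω := fun ω =>
    Finset.sum_nonneg fun k _ => mul_nonneg (Complex.normSq_nonneg _) (halfPoisson_nonneg _)
  have hPm : Measurable P := by
    have := continuous_halfPoisson.measurable
    fun_prop
  set c : ℝ := ((l : ℕ) + 1) / (n : ℝ) ^ 2 with hc
  have hc0 : 0 ≤ c := by positivity
  have hsq : ∀ f : ℝ → ℂ, eLpNorm f 2 ^ 2 = ∫⁻ ξ, ‖f ξ‖ₑ ^ 2 := fun f => by
    simpa using eLpNorm_nnreal_pow_eq_lintegral (f := f) (p := 2) (μ := volume) (by norm_num)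
  have hU1 : ∫⁻ ξ, ‖U ξ‖ₑ ^ 2 = 1 := by
    rw [← hsq, ← Lp.enorm_def, ← ofReal_norm, hU, Lp.norm_fourier_eq, hu]
    simp
  have hdec : ∀ᵐ ξ : ℝ, (n : ℝ) ≤ |2 * Real.pi * ξ| →
      ‖U ξ‖ ≤ K * |2 * Real.pi * ξ| ^ (-q') := by
    filter_upwards [quasiMeasurePreserving_two_pi_mul.ae hdecay] with ξ hξ hle
    have h1 := hξ (hns.trans hle)
    rw [angularFourier, mul_div_cancel_left₀ _ (by positivity)] at h1
    refine h1.trans ?_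
    gcongr
    exact hn1'.trans hle
  set G : ℝ → ℝ≥0∞ := {ω : ℝ | (n : ℝ) ≤ |ω|}.indicator
    (fun ω => ENNReal.ofReal (P ω * (|ω| ^ (-q')) ^ 2)) with hG
  have hset : MeasurableSet {ω : ℝ | (n : ℝ) ≤ |ω|} :=
    measurableSet_le measurable_const measurable_abs
  have hGm : Measurable G := by
    refine Measurable.indicator ?_ hset
    have : Measurable fun ω : ℝ => |ω| := measurable_abs
    fun_prop
  have hGint : ∫⁻ ξ : ℝ, G (2 * Real.pi * ξ) ≤ ENNReal.ofReal R := by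
    refine (lintegral_comp_two_pi_mul_le G hGm).trans ?_
    rw [hG, lintegral_indicator hset]
    exact lintegral_poisson_le hn1 (fun k => Complex.normSq_nonneg _)
      (fun T hT => h.sum_poisson_le_one hT) hq'
  have hpt : ∀ᵐ ξ : ℝ, ‖𝓕 (impulseDiff n l) ξ * U ξ‖ₑ ^ 2
      ≤ ENNReal.ofReal (c * 6) * ‖U ξ‖ₑ ^ 2
        + ENNReal.ofReal (c * K ^ 2) * G (2 * Real.pi * ξ) := by
    filter_upwards [hdec] with ξ hξ
    obtain ⟨h1, h2⟩ := h.norm_fourier_impulseDiff_sq_le l ξ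
    have e : ‖𝓕 (impulseDiff n l) ξ * U ξ‖ₑ ^ 2
        = ENNReal.ofReal (‖𝓕 (impulseDiff n l) ξ‖ ^ 2) * ‖U ξ‖ₑ ^ 2 := by
      rw [enorm_mul, mul_pow, ENNReal.ofReal_pow (norm_nonneg _), ofReal_norm]
    rw [e]
    rcases le_total |2 * Real.pi * ξ| n with hlow | hhigh
    · refine le_add_right ?_
      gcongr
      exact h1.trans (mul_le_mul_of_nonneg_left (h2 hlow) hc0)
    · refine le_add_left ?_
      have hm : 2 * Real.pi * ξ ∈ {ω : ℝ | (n : ℝ) ≤ |ω|} := hhigh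
      rw [hG, Set.indicator_of_mem hm, ← ofReal_norm, ← ENNReal.ofReal_pow (norm_nonneg _),
        ← ENNReal.ofReal_mul (by positivity), ← ENNReal.ofReal_mul (by positivity)]
      refine ENNReal.ofReal_le_ofReal ?_
      calc ‖𝓕 (impulseDiff n l) ξ‖ ^ 2 * ‖U ξ‖ ^ 2
          ≤ (c * P (2 * Real.pi * ξ)) * (K * |2 * Real.pi * ξ| ^ (-q')) ^ 2 := by
            have := hP0 (2 * Real.pi * ξ)
            have := hξ hhigh
            gcongr
        _ = c * K ^ 2 * (P (2 * Real.pi * ξ) * (|2 * Real.pi * ξ| ^ (-q')) ^ 2) := by ring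
  have hint : ∫⁻ ξ, ‖𝓕 (impulseDiff n l) ξ * U ξ‖ₑ ^ 2
      ≤ ENNReal.ofReal ((√(6 + K ^ 2 * R) * (n : ℝ)⁻¹ * √((l : ℕ) + 1)) ^ 2) := by
    calc _ ≤ ∫⁻ ξ, (ENNReal.ofReal (c * 6) * ‖U ξ‖ₑ ^ 2
          + ENNReal.ofReal (c * K ^ 2) * G (2 * Real.pi * ξ)) := lintegral_mono_ae hpt
      _ = ENNReal.ofReal (c * 6) * (∫⁻ ξ, ‖U ξ‖ₑ ^ 2)
          + ENNReal.ofReal (c * K ^ 2) * ∫⁻ ξ, G (2 * Real.pi * ξ) := by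
        rw [lintegral_add_right _ (by fun_prop), lintegral_const_mul' _ _ ENNReal.ofReal_ne_top,
          lintegral_const_mul' _ _ ENNReal.ofReal_ne_top]
      _ ≤ ENNReal.ofReal (c * 6) * 1 + ENNReal.ofReal (c * K ^ 2) * ENNReal.ofReal R := by
        rw [hU1]
        gcongr
      _ = _ := by
        rw [mul_one, ← ENNReal.ofReal_mul (by positivity), ← ENNReal.ofReal_add (by positivity)
          (by positivity), mul_pow, mul_pow, Real.sq_sqrt (by positivity),
          Real.sq_sqrt (by positivity), hc]
        congr 1
        field_simp
  rw [← hsq, ENNReal.ofReal_pow (by positivity)] at hint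
  exact (ENNReal.pow_right_strictMono two_ne_zero).le_iff_le.1 hint

end
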